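/- Let $F$ be a non-archimedean local field with ring of integers $\mathcal{O}$, maximal ideal $\mathfrak{m}=(\pi)$, and residue field with $q$ elements and of characteristic $p$; write $\mathcal{O}_\alpha=\mathcal{O}/\mathfrak{m}^\alpha$. Let $a_1,\dots,a_n\in\mathbb{Z}^m$ be vectors with non-zero image in $F^m$, and assume that $p$ is larger than the absolute value of every minor of the $n\times m$ matrix with rows $a_1,\dots,a_n$. Let $\mathcal{A}$ be the central arrangement in $F^m$ of the hyperplanes $H_i=\{v : \langle v,a_i\rangle=0\}$, and let $\mu(x,y)=\sum_{i=1}^n x_iy_ia_i$ be the associated moment map. $\mathcal{A}$ is called essential if the $a_i$ span $(F^m)^*\cong F^m$, and coloop-free if $a_i\in\operatorname{span}\{a_j : j\ne i\}$ for every $i$. For $I\subseteq\{1,\dots,n\}$ put $H_I=\bigcap_{i\in I}H_i$; $I$ is a flat if $I=\{i : H_I\subseteq H_i\}$. The flats, ordered by inclusion, form the poset $L(\mathcal{A})$, with smallest element $\emptyset$ and largest element $\infty=\{1,\dots,n\}$. For a flat $I$, let $\mathcal{A}_I$ be the arrangement of the $H_i/H_I$ ($i\in I$) in $F^m/H_I$,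 let $\mathcal{A}^I$ be the arrangement of the $H_i\cap H_I$ ($i\notin I$) in $H_I$, and for flats $I\subseteq J$ put $\mathcal{A}_J^I=(\mathcal{A}_J)^I$. The rank $\operatorname{rk}$ of an arrangement is the dimension of the span of its normal vectors, and $\delta_I=n-|I|+\operatorname{rk}(\mathcal{A}_I)$. The characteristic polynomial of a central arrangement $\mathcal{B}$ in $V$ with normal vectors $b_i$ is $\chi_{\mathcal{B}}(t)=\sum_{I\in L(\mathcal{B})}\nu(\emptyset,I)\,t^{\dim V-\dim\operatorname{span}\{b_i : i\in I\}}$, where $\nu$ is the Möbius function of $L(\mathcal{B})$. Then the limit $$B_\mu=\lim_{\alpha\to\infty}q^{-\alpha(2n-m)}\,\bigl|\{(x,y)\in\mathcal{O}_\alpha^n\times\mathcal{O}_\alpha^n : \mu(x,y)=0\}\bigr|$$ exists in $[0,\infty]$, and it is finite if and only if $\mathcal{A}$ is essential and coloop-free. In this case $$B_\mu=\sum_{\infty=I_0\supsetneq I_1\supsetneq\dots\supsetneq I_r}q^{-\operatorname{rk}(\mathcal{A}^{I_r})}\prod_{i=1}^r\frac{\chi_{\mathcal{A}_{I_{i-1}}^{I_i}}(q)}{q^{\delta_{I_i}-m}-1},$$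 where the sum is over all chains of flats of $\mathcal{A}$ of length $r\ge0$ that start at $\infty$. -/

import Mathlib

open Filter Topology ValuativeRel
open scoped ENNReal

/-- A central hyperplane arrangement in a vector space `V`, given by nonzero normal covectors
`a i`; the hyperplanes are `H i = {v | a i v = 0}`, repetitions being allowed. -/
structure CentralArrangement (k V ι : Type*) [Field k] [AddCommGroup V] [Module k V] where
  normal : ι → Module.Dual k V
  normal_ne_zero : ∀ i, normal i ≠ 0

namespace CentralArrangement

variable {k V ι : Type*} [Field k] [AddCommGroup V] [Module k V]
  (A : CentralArrangement k V ι)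

/-- The hyperplane `H i`. -/
def hyperplane (i : ι) : Submodule k V := LinearMap.ker (A.normal i)

/-- `H_I`, the intersection of the hyperplanes `H i` for `i ∈ I`. -/
def inter (I : Set ι) : Submodule k V := ⨅ i ∈ I, A.hyperplane i

/-- `I` is a flat if `I = {i | H_I ⊆ H i}` (`H_I` is nonempty since the arrangement is central). -/
def IsFlat (I : Set ι) : Prop := I = {i | A.inter I ≤ A.hyperplane i}

/-- The rank of the arrangement, the dimension of the span of the normal covectors. -/
noncomputable def rank : ℕ := Module.finrank k (Submodule.span k (Set.range A.normal))

/-- The arrangement is essential if the normal covectors span `V*`. -/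
def IsEssential : Prop := Submodule.span k (Set.range A.normal) = ⊤

/-- The arrangement is coloop-free if each normal covector lies in the span of the other ones. -/
def IsColoopFree : Prop :=
  ∀ i, A.normal i ∈ Submodule.span k (A.normal '' {j | j ≠ i})

/-- The poset `L(A)` of flats, ordered by inclusion. -/
abbrev Flat : Type _ := {I : Set ι // A.IsFlat I}

theorem mem_inter {I : Set ι} {v : V} : v ∈ A.inter I ↔ ∀ i ∈ I, A.normal i v = 0 := by
  simp [inter, hyperplane]

theorem isFlat_univ : A.IsFlat Set.univ := by
  refine (Set.eq_univ_of_forall fun i v hv => ?_).symm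
  exact A.mem_inter.1 hv i (Set.mem_univ i)

theorem isFlat_empty : A.IsFlat ∅ := by
  refine (Set.eq_empty_of_forall_notMem fun i hi => A.normal_ne_zero i ?_).symm
  ext v
  exact hi (A.mem_inter.2 (by simp))

/-- The maximal flat `∞`, consisting of all indices. -/
def topFlat : A.Flat := ⟨Set.univ, A.isFlat_univ⟩

/-- The minimal flat `∅`. -/
def emptyFlat : A.Flat := ⟨∅, A.isFlat_empty⟩

noncomputable instance [Finite ι] : Fintype A.Flat := Fintype.ofFinite _

noncomputable instance : DecidableEq A.Flat := Classical.decEq _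

noncomputable instance [Finite ι] : LocallyFiniteOrder A.Flat := by
  classical exact Fintype.toLocallyFiniteOrder

/-- The corank of a set `I` of indices, `dim V - rk I`. -/
noncomputable def corank (I : Set ι) : ℕ :=
  Module.finrank k V - Module.finrank k (Submodule.span k (A.normal '' I))

/-- The characteristic polynomial `∑ ν(∅, I) t ^ crk I` over the flats `I`, with `ν` the Möbius
function of the poset of flats. -/
noncomputable def charPoly [Finite ι] : Polynomial ℤ :=
  ∑ I : A.Flat, Polynomial.C (IncidenceAlgebra.mu ℤ A.emptyFlat I) * Polynomial.X ^ A.corank I.1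

/-- The localization `A_I`: the arrangement of the `H i / H_I`, `i ∈ I`, in `V / H_I`. -/
def localization (I : Set ι) : CentralArrangement k (V ⧸ A.inter I) I where
  normal i := (A.inter I).liftQ (A.normal i) fun _ hv => A.mem_inter.1 hv i i.2
  normal_ne_zero i h := A.normal_ne_zero i <| by
    ext v
    exact DFunLike.congr_fun h (Submodule.Quotient.mk v)

/-- The restriction `A^I` to a flat `I`: the arrangement of the `H i ∩ H_I`, `i ∉ I`, in `H_I`. -/
def restriction (I : Set ι) (hI : A.IsFlat I) :
    CentralArrangement k (A.inter I) {i // i ∉ I} where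
  normal i := (A.normal i).domRestrict (A.inter I)
  normal_ne_zero i h := i.2 <| by
    have hi : i.1 ∈ {i | A.inter I ≤ A.hyperplane i} :=
      fun v hv => LinearMap.mem_ker.2 (DFunLike.congr_fun h ⟨v, hv⟩)
    rw [← show I = _ from hI] at hi
    exact hi

/-- A flat contained in `J` is a flat of the localization at `J`. -/
theorem isFlat_localization {I J : Set ι} (hI : A.IsFlat I) (_hIJ : I ⊆ J) :
    (A.localization J).IsFlat {j : J | j.1 ∈ I} := by
  ext j
  constructor
  · intro hj v hv
    exact (A.localization J).mem_inter.1 hv j hj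
  · intro hj
    have hmem : j.1 ∈ {i | A.inter I ≤ A.hyperplane i} := by
      intro v hv
      have hq : (Submodule.Quotient.mk v : V ⧸ A.inter J) ∈
          (A.localization J).inter {j : J | j.1 ∈ I} :=
        (A.localization J).mem_inter.2 fun i hi => A.mem_inter.1 hv i.1 hi
      exact hj hq
    rw [← show I = _ from hI] at hmem
    exact hmem

/-- The arrangement `A_J^I = (A_J)^I` for flats `I ⊆ J`. -/
def subquotient (I J : A.Flat) (hIJ : I ≤ J) :=
  (A.localization J.1).restriction {j : J.1 | j.1 ∈ I.1} (A.isFlat_localization I.2 hIJ)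

/-- `δ_I = n - |I| + rk A_I`. -/
noncomputable def delta (I : Set ι) : ℤ :=
  (Nat.card ι : ℤ) - I.ncard + (A.localization I).rank

/-- The proper chains `∞ = I₀ ⊋ I₁ ⊋ ⋯ ⊋ I_r` of flats of length `r`. -/
abbrev Chain (r : ℕ) : Type _ := {c : Fin (r + 1) → A.Flat // c 0 = A.topFlat ∧ StrictAnti c}

noncomputable instance [Finite ι] (r : ℕ) : Fintype (A.Chain r) := Fintype.ofFinite _

theorem Chain.succ_le {A : CentralArrangement k V ι} {r : ℕ} (c : A.Chain r) (i : Fin r) :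
    c.1 i.succ ≤ c.1 i.castSucc :=
  (c.2.2 i.castSucc_lt_succ).le

/-- The length of a chain is at most the number of hyperplanes. -/
theorem Chain.length_le [Finite ι] {A : CentralArrangement k V ι} {r : ℕ} (c : A.Chain r) :
    r ≤ Nat.card ι := by
  have h : ∀ j : Fin (r + 1), (c.1 j).1.ncard + j.1 ≤ Nat.card ι := by
    intro j
    induction j using Fin.induction with
    | zero => simpa using Set.ncard_le_card (c.1 0).1
    | succ i ih =>
      have hlt : (c.1 i.succ).1.ncard < (c.1 i.castSucc).1.ncard :=
        Set.ncard_lt_ncard (c.2.2 i.castSucc_lt_succ) (Set.toFinite _)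
      simp only [Fin.val_castSucc, Fin.val_succ] at ih ⊢
      omega
  have := h (Fin.last r)
  simp only [Fin.val_last] at this
  omega

end CentralArrangement

/-- The central arrangement in `k^m` whose normal covectors are the images in `k` of the rows of an
integer matrix. -/
def Matrix.rowArrangement (k : Type*) [Field k] {n m : ℕ} (a : Matrix (Fin n) (Fin m) ℤ)
    (ha : ∀ i, ∃ j, (a i j : k) ≠ 0) : CentralArrangement k (Fin m → k) (Fin n) where
  normal i := ∑ j, (a i j : k) • LinearMap.proj j
  normal_ne_zero i h := by
    obtain ⟨j, hj⟩ := ha i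
    refine hj ?_
    have := DFunLike.congr_fun h (Pi.single j 1)
    simpa [Pi.single_apply] using this

/-- The moment map `μ(x, y) = ∑ i, x i * y i * a i` from `R^n × R^n` to `R^m`. -/
def momentMap (R : Type*) [CommRing R] {n m : ℕ} (a : Matrix (Fin n) (Fin m) ℤ)
    (x y : Fin n → R) : Fin m → R :=
  fun j => ∑ i, x i * y i * (a i j : R)

/-- The number of solutions of `μ = 0` in `R^n × R^n`. -/
noncomputable def momentZeroCount (R : Type*) [CommRing R] {n m : ℕ}
    (a : Matrix (Fin n) (Fin m) ℤ) : ℕ :=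
  Nat.card {z : (Fin n → R) × (Fin n → R) // momentMap R a z.1 z.2 = 0}

/-! Fourier inversion on `O/𝔪^α` turns the normalised count into a sum over ξ in `(O/𝔪^α)^m` of the
products ∏ w(⟨a_i, ξ⟩), where w(x) is the proportion of the ring annihilated by x
(`momentZeroCount_div_card_zpow`). Write ξ = s(v) + πη, with v the reduction of ξ modulo π. Since
nonzero minors are units, the lift s(v) can be chosen so that the rows vanishing at v also vanish at
s(v). For such a row, ⟨a_i, ξ⟩ = π⟨a_i, η⟩ has the weight of ⟨a_i, η⟩ one level down; for any other
row it is a unit, and the weight of a unit drops by 1/q. Letting f_α(J) be the sum in which rows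
outside the flat J carry the weight of a unit, this gives f_0 = 1 and f_{α+1}(J) = ∑_I T(J,I)
f_α(I), where T(J,I) is q^{|I|-n} times the number of v at which exactly the rows I among J vanish
(`weightSum_succ`, `sum_rowZeroSet_eq_sum_flat`).

The matrix T is triangular with T(I,I) = q^{m-δ_I}. In the essential and coloop-free case the
diagonal is 1 at ∞ and less than 1 elsewhere (`finrank_inter_add_ncard_lt`). Hence f_α(I) is
summable in α for I ≠ ∞, f_α(∞) converges, and solving the triangular system for the sums over α
yields a sum over chains (`tendsto_top_of_triangular`). Otherwise either T(∞,∞) > 1, or another flat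
with diagonal entry at least 1 feeds into ∞, and f_α(∞) diverges (`diverging_entries`).

Möbius inversion identifies the point count in T(J,I) with q^{dim H_J} χ(q), where χ belongs to
A_J^I (`card_stratum`); dimensions over F and over the residue field agree because the same minors
are nonzero in both. Along a chain the powers q^{dim H} telescope to the factor q^{-rk}. -/

/-! ### Minors of an integer matrix and linear systems over rings where they are units -/

/-- The linear form on `R^m` given by the `i`-th row of an integer matrix. -/
def Matrix.rowForm (R : Type*) [CommRing R] {n m : ℕ} (a : Matrix (Fin n) (Fin m) ℤ) (i : Fin n) :
    (Fin m → R) →ₗ[R] R :=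
  ∑ j, (a i j : R) • LinearMap.proj j

theorem Matrix.rowForm_apply {R : Type*} [CommRing R] {n m : ℕ} (a : Matrix (Fin n) (Fin m) ℤ)
    (i : Fin n) (v : Fin m → R) : a.rowForm R i v = ∑ j, (a i j : R) * v j := by
  simp [Matrix.rowForm]

theorem Matrix.map_rowForm {R S : Type*} [CommRing R] [CommRing S] (f : R →+* S) {n m : ℕ}
    (a : Matrix (Fin n) (Fin m) ℤ) (i : Fin n) (v : Fin m → R) :
    f (a.rowForm R i v) = a.rowForm S i (fun j => f (v j)) := by
  simp [Matrix.rowForm_apply]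

theorem Matrix.det_submatrix_ne_zero_injective {R : Type*} [CommRing R] {n m l : ℕ}
    (a : Matrix (Fin n) (Fin m) R) (r : Fin l → Fin n) (c : Fin l → Fin m)
    (h : (a.submatrix r c).det ≠ 0) : Function.Injective r ∧ Function.Injective c := by
  constructor
  · intro i j hij
    by_contra hne
    exact h (Matrix.det_zero_of_row_eq hne (by ext k; simp [hij]))
  · intro i j hij
    by_contra hne
    exact h (Matrix.det_zero_of_column_eq hne (by intro k; simp [hij]))

/-- A maximal nonvanishing minor of the rows in `S` expresses all the rows in `S` through its own
rows. -/
theorem Matrix.exists_maximal_minor {n m : ℕ} (a : Matrix (Fin n) (Fin m) ℤ) (S : Set (Fin n)) :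
    ∃ (l : ℕ) (r : Fin l → Fin n) (c : Fin l → Fin m) (u : Fin n → Fin l → ℤ),
      (∀ b, r b ∈ S) ∧ (a.submatrix r c).det ≠ 0 ∧
        ∀ i ∈ S, ∀ j, (a.submatrix r c).det * a i j = ∑ b, u i b * a (r b) j := by
  classical
  let P : ℕ → Prop := fun l => ∃ (r : Fin l → Fin n) (c : Fin l → Fin m),
    (∀ b, r b ∈ S) ∧ (a.submatrix r c).det ≠ 0
  have h0 : P 0 := ⟨Fin.elim0, Fin.elim0, fun b => b.elim0, by simp⟩
  have hP : P (Nat.findGreatest P n) := Nat.findGreatest_spec (Nat.zero_le n) h0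
  have hlt : ¬ P (Nat.findGreatest P n + 1) := fun h => by
    have hle : Nat.findGreatest P n + 1 ≤ n := by
      obtain ⟨r, c, -, hd⟩ := h
      simpa using Fintype.card_le_of_injective r (a.det_submatrix_ne_zero_injective r c hd).1
    exact absurd (Nat.le_findGreatest hle h) (by omega)
  generalize Nat.findGreatest P n = l at hP hlt
  obtain ⟨r, c, hr, hd⟩ := hP
  refine ⟨l, r, c, fun i b => ∑ t, a i (c t) * (a.submatrix r c).adjugate t b, hr, hd, ?_⟩
  intro i hi j
  set M := a.submatrix r c with hM
  -- The minor bordered by row `i` and column `j` vanishes: by maximality of `l`, or through a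
  -- repeated row or column.
  let N : Matrix (Fin l ⊕ Unit) (Fin l ⊕ Unit) ℤ :=
    a.submatrix (Sum.elim r fun _ => i) (Sum.elim c fun _ => j)
  have hN : N.det = 0 := by
    by_contra hne
    let e : Fin (l + 1) ≃ Fin l ⊕ Unit :=
      finSumFinEquiv.symm.trans (Equiv.sumCongr (Equiv.refl _) (Equiv.ofUnique _ _))
    refine hlt ⟨(Sum.elim r fun _ => i) ∘ e, (Sum.elim c fun _ => j) ∘ e, fun b => ?_, ?_⟩
    · rcases h : e b with x | x <;> simp [h, hr, hi]
    · rw [← Matrix.submatrix_submatrix, Matrix.det_submatrix_equiv_self]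
      exact hne
  -- Over `ℚ` the block `M` is invertible, so the Schur complement of `N` vanishes; multiplying it
  -- by `det M` replaces the inverse by the integral adjugate.
  have hNQ : (N.map (Int.cast : ℤ → ℚ)).det = 0 := by
    have := congrArg (Int.cast : ℤ → ℚ) hN
    simpa [Int.cast_det] using this
  let MQ := M.map (Int.cast : ℤ → ℚ)
  have hMQ : MQ.det ≠ 0 := by
    simpa [MQ, ← Int.cast_det] using hd
  let _ : Invertible MQ := Matrix.invertibleOfIsUnitDet _ hMQ.isUnit
  have hblocks : N.map (Int.cast : ℤ → ℚ) = Matrix.fromBlocks MQ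
      (Matrix.of fun b _ => (a (r b) j : ℚ)) (Matrix.of fun _ t => (a i (c t) : ℚ))
      (Matrix.of fun _ _ => (a i j : ℚ)) := by
    ext x y
    rcases x with x | x <;> rcases y with y | y <;> simp [N, MQ, M]
  rw [hblocks, Matrix.det_fromBlocks₁₁, mul_eq_zero, or_iff_right hMQ] at hNQ
  have hinv : MQ.det • ⅟MQ = MQ.adjugate := by
    rw [Matrix.invOf_eq_nonsing_inv, Matrix.inv_def, smul_smul, Ring.mul_inverse_cancel _ hMQ.isUnit,
      one_smul]
  have hadj : MQ.adjugate = M.adjugate.map (Int.cast : ℤ → ℚ) :=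
    (RingHom.map_adjugate (Int.castRingHom ℚ) M).symm
  rw [Matrix.det_unique, Matrix.sub_apply, sub_eq_zero] at hNQ
  have h2 := congrArg (fun x => MQ.det * x) hNQ
  change _ = (MQ.det • (_ * _ * _ : Matrix Unit Unit ℚ)) default default at h2
  rw [← Matrix.smul_mul, ← Matrix.mul_smul, hinv, hadj] at h2
  have h3 : ((M.det * a i j : ℤ) : ℚ) =
      ((∑ b, (∑ t, a i (c t) * M.adjugate t b) * a (r b) j : ℤ) : ℚ) := by
    push_cast
    simpa [Matrix.mul_apply, MQ] using h2
  exact_mod_cast h3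

/-- The bound is given for increasing selections only. A nonzero minor has distinct rows and
columns, and sorting them changes only the sign. -/
theorem Matrix.abs_det_submatrix_lt {n m : ℕ} (a : Matrix (Fin n) (Fin m) ℤ) {p : ℤ}
    (hminors : ∀ (l : ℕ) (r : Fin l ↪o Fin n) (c : Fin l ↪o Fin m),
      |(a.submatrix r c).det| < p) {l : ℕ} (r : Fin l → Fin n) (c : Fin l → Fin m)
    (h : (a.submatrix r c).det ≠ 0) : |(a.submatrix r c).det| < p := by
  obtain ⟨hr, hc⟩ := a.det_submatrix_ne_zero_injective r c h
  let r' : Fin l ↪o Fin n := OrderEmbedding.ofStrictMono (r ∘ Tuple.sort r)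
    ((Tuple.monotone_sort r).strictMono_of_injective (hr.comp (Tuple.sort r).injective))
  let c' : Fin l ↪o Fin m := OrderEmbedding.ofStrictMono (c ∘ Tuple.sort c)
    ((Tuple.monotone_sort c).strictMono_of_injective (hc.comp (Tuple.sort c).injective))
  have h1 := hminors l r' c'
  have h2 : a.submatrix r' c' =
      ((a.submatrix r c).submatrix (Tuple.sort r) id).submatrix id (Tuple.sort c) := by
    ext; simp [r', c']
  rw [h2, Matrix.det_permute', Matrix.det_permute, abs_mul, abs_mul] at h1
  have hu : ∀ u : ℤˣ, |(u : ℤ)| = 1 := fun u => Int.isUnit_iff_abs_eq.1 u.isUnit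
  simpa [hu] using h1

section

variable {n m l : ℕ} (a : Matrix (Fin n) (Fin m) ℤ) (r : Fin l → Fin n) (c : Fin l → Fin m)

/-- The solution is the inverse of the minor applied to `y`, placed in the columns `c`. Its entries
are combinations of those of `y`, hence the ideal clause, which serves to correct a lift without
changing its reduction. -/
theorem Matrix.exists_rowForm_eq {R : Type*} [CommRing R]
    (hd : IsUnit ((a.submatrix r c).det : R)) (y : Fin l → R) :
    ∃ w : Fin m → R, (∀ b, a.rowForm R (r b) w = y b) ∧
      ∀ J : Ideal R, (∀ b, y b ∈ J) → ∀ j, w j ∈ J := by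
  let M : Matrix (Fin l) (Fin l) R := (a.submatrix r c).map (Int.cast : ℤ → R)
  have hM : IsUnit M.det := by simpa [M, ← Int.cast_det] using hd
  refine ⟨∑ t, Pi.single (c t) ((M⁻¹).mulVec y t), fun b => ?_,
    fun J hJ j => ?_⟩
  swap
  · rw [Finset.sum_apply]
    refine J.sum_mem fun t _ => ?_
    rw [Pi.single_apply]
    split_ifs
    · exact (J.sum_mem fun s _ => J.mul_mem_left (M⁻¹ t s) (hJ s) : ∑ s, M⁻¹ t s * y s ∈ J)
    · exact J.zero_mem
  have h : ∀ t, a.rowForm R (r b) (Pi.single (c t) ((M⁻¹).mulVec y t)) =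
      M b t * (M⁻¹).mulVec y t := by
    intro t
    simp [Matrix.rowForm_apply, Pi.single_apply, M]
  rw [map_sum, Finset.sum_congr rfl fun t _ => h t]
  change (M.mulVec ((M⁻¹).mulVec y)) b = _
  rw [Matrix.mulVec_mulVec, Matrix.mul_nonsing_inv _ hM, Matrix.one_mulVec]

theorem Matrix.rowForm_eq_zero_of_minor {R : Type*} [CommRing R]
    (hd : IsUnit ((a.submatrix r c).det : R)) {i : Fin n} {u : Fin l → ℤ}
    (hu : ∀ j, (a.submatrix r c).det * a i j = ∑ b, u b * a (r b) j) {v : Fin m → R}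
    (hv : ∀ b, a.rowForm R (r b) v = 0) : a.rowForm R i v = 0 := by
  refine hd.mul_right_eq_zero.1 ?_
  have h : ∀ j, ((a.submatrix r c).det : R) * ((a i j : R) * v j) =
      ∑ b, (u b : R) * ((a (r b) j : R) * v j) := by
    intro j
    rw [← mul_assoc, ← Int.cast_mul, hu j]
    push_cast
    rw [Finset.sum_mul]
    simp [mul_assoc]
  rw [Matrix.rowForm_apply, Finset.mul_sum, Finset.sum_congr rfl fun j _ => h j, Finset.sum_comm]
  refine Finset.sum_eq_zero fun b _ => ?_
  rw [← Finset.mul_sum, ← Matrix.rowForm_apply, hv, mul_zero]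

end

/-- The vectors on which the rows in `S` vanish. -/
def Matrix.rowZeros (R : Type*) [CommRing R] {n m : ℕ} (a : Matrix (Fin n) (Fin m) ℤ)
    (S : Set (Fin n)) : Submodule R (Fin m → R) :=
  ⨅ i ∈ S, LinearMap.ker (a.rowForm R i)

theorem Matrix.mem_rowZeros {R : Type*} [CommRing R] {n m : ℕ} {a : Matrix (Fin n) (Fin m) ℤ}
    {S : Set (Fin n)} {v : Fin m → R} : v ∈ a.rowZeros R S ↔ ∀ i ∈ S, a.rowForm R i v = 0 := by
  simp [Matrix.rowZeros]

/-- All nonzero minors of `a` are invertible in `R`. -/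
def Matrix.UnitMinors (R : Type*) [CommRing R] {n m : ℕ} (a : Matrix (Fin n) (Fin m) ℤ) : Prop :=
  ∀ ⦃l : ℕ⦄ (r : Fin l → Fin n) (c : Fin l → Fin m), (a.submatrix r c).det ≠ 0 →
    IsUnit ((a.submatrix r c).det : R)

/-- The rows of a maximal minor map `K^m` onto `K^l` and have the same kernel as all rows in `S`. As
`l` is determined over the integers, the dimension does not see the field. -/
theorem Matrix.finrank_rowZeros {K : Type*} [Field K] {n m l : ℕ} (a : Matrix (Fin n) (Fin m) ℤ)
    (hK : a.UnitMinors K) {S : Set (Fin n)} {r : Fin l → Fin n} {c : Fin l → Fin m}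
    {u : Fin n → Fin l → ℤ} (hr : ∀ b, r b ∈ S) (hd : (a.submatrix r c).det ≠ 0)
    (hu : ∀ i ∈ S, ∀ j, (a.submatrix r c).det * a i j = ∑ b, u i b * a (r b) j) :
    l + Module.finrank K (a.rowZeros K S) = m := by
  let Φ : (Fin m → K) →ₗ[K] (Fin l → K) := LinearMap.pi fun b => a.rowForm K (r b)
  have hker : LinearMap.ker Φ = a.rowZeros K S := by
    ext v
    rw [LinearMap.mem_ker, Matrix.mem_rowZeros]
    constructor
    · intro h i hi
      exact a.rowForm_eq_zero_of_minor r c (hK r c hd) (hu i hi) fun b => congrFun h b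
    · intro h
      ext b
      exact h _ (hr b)
  have hrange : LinearMap.range Φ = ⊤ := LinearMap.range_eq_top.2 fun y => by
    obtain ⟨w, hw, -⟩ := a.exists_rowForm_eq r c (hK r c hd) y
    exact ⟨w, funext hw⟩
  have := LinearMap.finrank_range_add_finrank_ker Φ
  rwa [hker, hrange, finrank_top, Module.finrank_fin_fun, Module.finrank_fin_fun] at this

/-- The dimension of the common zero space of some rows does not depend on the field. -/
theorem Matrix.finrank_rowZeros_eq (K L : Type*) [Field K] [Field L] {n m : ℕ}
    (a : Matrix (Fin n) (Fin m) ℤ) (hK : a.UnitMinors K) (hL : a.UnitMinors L) (S : Set (Fin n)) :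
    Module.finrank K (a.rowZeros K S) = Module.finrank L (a.rowZeros L S) := by
  obtain ⟨l, r, c, u, hr, hd, hu⟩ := a.exists_maximal_minor S
  have h1 := a.finrank_rowZeros hK hr hd hu
  have h2 := a.finrank_rowZeros hL hr hd hu
  omega

/-- Common zeros of some rows lift along surjective ring homomorphisms. -/
theorem Matrix.exists_lift_rowZeros {R S : Type*} [CommRing R] [CommRing S] (f : R →+* S)
    (hf : Function.Surjective f) {n m : ℕ}
    (a : Matrix (Fin n) (Fin m) ℤ) (hR : a.UnitMinors R) (Z : Set (Fin n)) {v : Fin m → S}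
    (hv : v ∈ a.rowZeros S Z) : ∃ w ∈ a.rowZeros R Z, ∀ j, f (w j) = v j := by
  obtain ⟨l, r, c, u, hr, hd, hu⟩ := a.exists_maximal_minor Z
  choose g hg using hf
  have hgv : ∀ i, f (a.rowForm R i fun j => g (v j)) = a.rowForm S i v := fun i => by
    simp [Matrix.map_rowForm, hg]
  -- An arbitrary lift has values in the kernel of `f` on the chosen rows; subtracting a solution
  -- `w` with entries in that kernel makes them zero.
  obtain ⟨w, hw, hJ⟩ := a.exists_rowForm_eq r c (hR r c hd) fun b =>
    a.rowForm R (r b) fun j => g (v j)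
  refine ⟨(fun j => g (v j)) - w, Matrix.mem_rowZeros.2 fun i hi => ?_, fun j => ?_⟩
  · exact a.rowForm_eq_zero_of_minor r c (hR r c hd) (hu i hi) fun b => by
      rw [map_sub, hw, sub_self]
  · have h := hJ (RingHom.ker f) (fun b => by
      rw [RingHom.mem_ker, hgv]
      exact Matrix.mem_rowZeros.1 hv _ (hr b)) j
    rw [RingHom.mem_ker] at h
    simp [h, hg]

/-! ### Flats, dimensions and Möbius inversion for subquotient arrangements -/

namespace CentralArrangement

variable {k V ι : Type*} [Field k] [AddCommGroup V] [Module k V] (A : CentralArrangement k V ι)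

/-- The set of indices of `A` corresponding to a set of indices of `A_J^I`, with `I` adjoined. -/
def unionSubquotient (I J : Set ι) (K : Set {j : J // j ∉ {j : J | j.1 ∈ I}}) : Set ι :=
  {i | i ∈ I ∨ ∃ j ∈ K, j.1.1 = i}

theorem mem_inter_subquotient (I J : A.Flat) (hIJ : I ≤ J)
    (K : Set {j : J.1 // j ∉ {j : J.1 | j.1 ∈ I.1}}) {v : V}
    (hv : (Submodule.Quotient.mk v : V ⧸ A.inter J.1) ∈
      (A.localization J.1).inter {j : J.1 | j.1 ∈ I.1}) :
    (⟨Submodule.Quotient.mk v, hv⟩ : (A.localization J.1).inter {j : J.1 | j.1 ∈ I.1}) ∈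
      (A.subquotient I J hIJ).inter K ↔ v ∈ A.inter (unionSubquotient I.1 J.1 K) := by
  rw [mem_inter, A.mem_inter]
  constructor
  · rintro h i (hi | ⟨j, hj, rfl⟩)
    · exact (A.localization J.1).mem_inter.1 hv ⟨i, hIJ hi⟩ hi
    · exact h j hj
  · exact fun h j hj => h j.1.1 (Or.inr ⟨j, hj, rfl⟩)

theorem mk_mem_inter_localization (I J : Set ι) (hIJ : I ⊆ J) {v : V} :
    (Submodule.Quotient.mk v : V ⧸ A.inter J) ∈
      (A.localization J).inter {j : J | j.1 ∈ I} ↔ v ∈ A.inter I := by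
  rw [mem_inter, A.mem_inter]
  exact ⟨fun h i hi => h ⟨i, hIJ hi⟩ hi, fun h j hj => h j.1 hj⟩

theorem inter_anti {S T : Set ι} (h : S ⊆ T) : A.inter T ≤ A.inter S :=
  fun _ hv => A.mem_inter.2 fun i hi => A.mem_inter.1 hv i (h hi)

theorem isFlat_iff {I : Set ι} : A.IsFlat I ↔ ∀ i, A.inter I ≤ A.hyperplane i → i ∈ I := by
  constructor
  · intro h i hi
    rw [h]
    exact hi
  · exact fun h => Set.Subset.antisymm (fun i hi v hv => A.mem_inter.1 hv i hi) h

theorem isFlat_subquotient_iff (I J : A.Flat) (hIJ : I ≤ J)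
    (K : Set {j : J.1 // j ∉ {j : J.1 | j.1 ∈ I.1}}) :
    (A.subquotient I J hIJ).IsFlat K ↔ A.IsFlat (unionSubquotient I.1 J.1 K) := by
  rw [isFlat_iff, isFlat_iff]
  constructor
  · intro h i hi
    by_cases hiI : i ∈ I.1
    · exact Or.inl hiI
    have hiJ : i ∈ J.1 := by
      refine A.isFlat_iff.1 J.2 i (le_trans (A.inter_anti ?_) hi)
      rintro i (hi | ⟨j, -, rfl⟩)
      · exact hIJ hi
      · exact j.1.2
    refine Or.inr ⟨⟨⟨i, hiJ⟩, hiI⟩, h _ ?_, rfl⟩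
    rintro ⟨w, hw⟩ hwK
    obtain ⟨v, rfl⟩ := Submodule.Quotient.mk_surjective _ w
    exact hi ((A.mem_inter_subquotient I J hIJ K hw).1 hwK)
  · intro h j hj
    have hmem : j.1.1 ∈ unionSubquotient I.1 J.1 K := by
      refine h _ fun v hv => ?_
      have hvI := (A.mk_mem_inter_localization I.1 J.1 hIJ (v := v)).2
        (A.inter_anti (fun i hi => Or.inl hi) hv)
      exact hj ((A.mem_inter_subquotient I J hIJ K hvI).2 hv)
    rcases hmem with hI | ⟨j', hj', he⟩
    · exact absurd hI j.2
    · rwa [← Subtype.ext (Subtype.ext he)]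

noncomputable instance : OrderTop A.Flat where
  top := A.topFlat
  le_top _ := Set.subset_univ _

theorem emptyFlat_le (K : A.Flat) : A.emptyFlat ≤ K := Set.empty_subset _

/-- Moebius inversion: the value of the characteristic polynomial counts the points on no
hyperplane. -/
theorem eval_charPoly_eq [Finite ι] (t c : ℤ) (N : A.Flat → ℤ)
    (hN : ∀ K : A.Flat, (∑ K' : A.Flat, open Classical in if K ≤ K' then N K' else 0) =
      c * t ^ A.corank K.1) :
    c * A.charPoly.eval t = N A.emptyFlat := by
  classical
  have h := IncidenceAlgebra.moebius_inversion_top (𝕜 := ℤ) N (fun K => c * t ^ A.corank K.1)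
    (fun K => by
      rw [← hN K, ← Finset.sum_filter]
      refine Finset.sum_congr ?_ fun _ _ => rfl
      ext K'
      simp) A.emptyFlat
  have huniv : Finset.Ici A.emptyFlat = Finset.univ := by
    ext K
    simp [A.emptyFlat_le K]
  rw [h, huniv, charPoly, Polynomial.eval_finsetSum, Finset.mul_sum]
  refine Finset.sum_congr rfl fun K _ => ?_
  simp only [Polynomial.eval_mul, Polynomial.eval_C, Polynomial.eval_pow, Polynomial.eval_X]
  ring

section

variable [FiniteDimensional k V]

theorem finrank_span_add_finrank_inter (S : Set ι) :
    Module.finrank k (Submodule.span k (A.normal '' S)) + Module.finrank k (A.inter S) =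
      Module.finrank k V := by
  have h : A.inter S = (Submodule.span k (A.normal '' S)).dualCoannihilator := by
    ext v
    rw [A.mem_inter, Submodule.mem_dualCoannihilator]
    constructor
    · intro hv φ hφ
      induction hφ using Submodule.span_induction with
      | mem x hx => obtain ⟨i, hi, rfl⟩ := hx; exact hv i hi
      | zero => simp
      | add x y _ _ hx hy => simp [hx, hy]
      | smul c x _ hx => simp [hx]
    · exact fun hv i hi => hv _ (Submodule.subset_span ⟨i, hi, rfl⟩)
  rw [h, Subspace.finrank_add_finrank_dualCoannihilator_eq]

theorem corank_eq_finrank_inter (S : Set ι) : A.corank S = Module.finrank k (A.inter S) := by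
  have := A.finrank_span_add_finrank_inter S
  rw [corank]
  omega

theorem rank_add_finrank_inter_univ :
    A.rank + Module.finrank k (A.inter Set.univ) = Module.finrank k V := by
  rw [rank, ← Set.image_univ, A.finrank_span_add_finrank_inter]

theorem isEssential_iff_inter_univ : A.IsEssential ↔ A.inter Set.univ = ⊥ := by
  have h := A.rank_add_finrank_inter_univ
  rw [IsEssential, ← Submodule.finrank_eq_zero (R := k)]
  constructor
  · intro he
    rw [rank, he, finrank_top, Subspace.dual_finrank_eq] at h
    omega
  · intro h0
    refine Submodule.eq_top_of_finrank_eq ?_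
    rw [Subspace.dual_finrank_eq]
    change A.rank = _
    omega

/-- The localization is essential in `V / H_I`, so its rank is the codimension of `H_I`. -/
theorem rank_localization_add (I : Set ι) :
    (A.localization I).rank + Module.finrank k (A.inter I) = Module.finrank k V := by
  have h := (A.localization I).rank_add_finrank_inter_univ
  have hbot : (A.localization I).inter Set.univ = ⊥ := by
    rw [eq_bot_iff]
    intro x hx
    obtain ⟨v, rfl⟩ := Submodule.Quotient.mk_surjective _ x
    rw [Submodule.mem_bot, Submodule.Quotient.mk_eq_zero]
    exact A.mem_inter.2 fun i hi => (A.localization I).mem_inter.1 hx ⟨i, hi⟩ (Set.mem_univ _)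
  rw [hbot, finrank_bot, add_zero] at h
  rw [h, Submodule.finrank_quotient_add_finrank]

theorem rank_restriction_add (I : Set ι) (hI : A.IsFlat I) :
    (A.restriction I hI).rank + Module.finrank k (A.inter Set.univ) =
      Module.finrank k (A.inter I) := by
  have h := (A.restriction I hI).rank_add_finrank_inter_univ
  have hmap : ((A.restriction I hI).inter Set.univ).map (A.inter I).subtype =
      A.inter Set.univ := by
    ext v
    rw [Submodule.mem_map, A.mem_inter]
    constructor
    · rintro ⟨w, hw, rfl⟩ i -
      by_cases hi : i ∈ I
      · exact A.mem_inter.1 w.2 i hi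
      · exact (A.restriction I hI).mem_inter.1 hw ⟨i, hi⟩ (Set.mem_univ _)
    · exact fun hv => ⟨⟨v, A.mem_inter.2 fun i _ => hv i (Set.mem_univ _)⟩,
        (A.restriction I hI).mem_inter.2 fun i _ => hv i.1 (Set.mem_univ _), rfl⟩
  rwa [← hmap, ← (Submodule.equivMapOfInjective _ (A.inter I).injective_subtype _).finrank_eq]

/-- The ambient space of `A_J^I` is `H_I / H_J`, and the intersection belonging to `K` is the image
of `H` of the union of `I` and `K`, which contains `H_J`. -/
theorem corank_subquotient_add (I J : A.Flat) (hIJ : I ≤ J)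
    (K : Set {j : J.1 // j ∉ {j : J.1 | j.1 ∈ I.1}}) :
    (A.subquotient I J hIJ).corank K + Module.finrank k (A.inter J.1) =
      Module.finrank k (A.inter (unionSubquotient I.1 J.1 K)) := by
  rw [corank_eq_finrank_inter]
  let W := (A.localization J.1).inter {j : J.1 | j.1 ∈ I.1}
  let U := A.inter (unionSubquotient I.1 J.1 K)
  have hU : A.inter J.1 ≤ U := A.inter_anti (by
    rintro i (hi | ⟨j, -, rfl⟩)
    · exact hIJ hi
    · exact j.1.2)
  have hmap : ((A.subquotient I J hIJ).inter K).map W.subtype = U.map (A.inter J.1).mkQ := by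
    ext x
    obtain ⟨v, rfl⟩ := Submodule.Quotient.mk_surjective _ x
    rw [Submodule.mem_map, Submodule.mem_map]
    constructor
    · rintro ⟨⟨w, hw⟩, hw', rfl⟩
      exact ⟨v, (A.mem_inter_subquotient I J hIJ K hw).1 hw', rfl⟩
    · rintro ⟨w, hw, hwv⟩
      have hwI := (A.mk_mem_inter_localization I.1 J.1 hIJ (v := w)).2
        (A.inter_anti (fun i hi => Or.inl hi) hw)
      exact ⟨⟨Submodule.Quotient.mk w, hwI⟩, (A.mem_inter_subquotient I J hIJ K hwI).2 hw, hwv⟩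
  have h1 : Module.finrank k ((A.subquotient I J hIJ).inter K) =
      Module.finrank k (U.map (A.inter J.1).mkQ) := by
    rw [← hmap]
    exact (LinearEquiv.finrank_eq (Submodule.equivMapOfInjective _ W.injective_subtype _))
  have h2 := LinearMap.finrank_range_add_finrank_ker ((A.inter J.1).mkQ.domRestrict U)
  have hker : LinearMap.ker ((A.inter J.1).mkQ.domRestrict U) =
      (A.inter J.1).comap U.subtype := by
    rw [LinearMap.domRestrict, LinearMap.ker_comp, Submodule.ker_mkQ]
  rw [LinearMap.range_domRestrict, hker,
    (Submodule.comapSubtypeEquivOfLe hU).finrank_eq] at h2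
  rw [h1, h2]

end

end CentralArrangement

/-! ### Triangular recursions and sums over chains -/

section

variable {P : Type*} [Fintype P]

/-- The `r`-th iterate of a finite matrix as a sum over paths. -/
theorem iterate_sum_mul_eq_sum_path (U : P → P → ℝ) (g : P → ℝ) (r : ℕ) (x : P) :
    ((fun (h : P → ℝ) y => ∑ z, U y z * h z)^[r] g) x =
      ∑ d : Fin r → P, (∏ i : Fin r, U ((Fin.cons x d : Fin (r + 1) → P) i.castSucc)
        ((Fin.cons x d : Fin (r + 1) → P) i.succ)) *
          g ((Fin.cons x d : Fin (r + 1) → P) (Fin.last r)) := by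
  induction r generalizing x with
  | zero => simp
  | succ r ih =>
    rw [Function.iterate_succ_apply', ← (Fin.consEquiv fun _ : Fin (r + 1) => P).sum_comp,
      Fintype.sum_prod_type]
    refine Finset.sum_congr rfl fun z _ => ?_
    rw [ih, Finset.mul_sum]
    refine Finset.sum_congr rfl fun d _ => ?_
    rw [Fin.prod_univ_succ, mul_assoc]
    rfl

variable [PartialOrder P]

theorem iterate_sum_mul_eq_sum_chain {U : P → P → ℝ} (hU : ∀ x y, ¬ y < x → U x y = 0)
    (g : P → ℝ) (r : ℕ) (x : P) [Fintype {c : Fin (r + 1) → P // c 0 = x ∧ StrictAnti c}] :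
    ((fun (h : P → ℝ) y => ∑ z, U y z * h z)^[r] g) x =
      ∑ c : {c : Fin (r + 1) → P // c 0 = x ∧ StrictAnti c},
        (∏ i : Fin r, U (c.1 i.castSucc) (c.1 i.succ)) * g (c.1 (Fin.last r)) := by
  rw [iterate_sum_mul_eq_sum_path]
  symm
  have hcons : ∀ c : {c : Fin (r + 1) → P // c 0 = x ∧ StrictAnti c},
      (Fin.cons x (Fin.tail c.1) : Fin (r + 1) → P) = c.1 := fun c => by
    conv_rhs => rw [← Fin.cons_self_tail c.1, c.2.1]
  refine Finset.sum_of_injOn (fun c => Fin.tail c.1) ?_ (fun _ _ => Finset.mem_coe.2 (Finset.mem_univ _))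
    ?_ ?_
  · intro c _ c' _ h
    apply Subtype.ext
    rw [← hcons c, ← hcons c']
    exact congrArg _ h
  · intro d _ hd
    by_contra hne
    refine hd ⟨⟨Fin.cons x d, rfl, ?_⟩, Finset.mem_coe.2 (Finset.mem_univ _), Fin.tail_cons _ _⟩
    rw [Fin.strictAnti_iff_succ_lt]
    intro i
    by_contra hlt
    exact hne (by rw [Finset.prod_eq_zero (Finset.mem_univ i) (hU _ _ hlt), zero_mul])
  · intro c _
    rw [hcons]

/-- Summing the recursion bounds `(1 - t)` times each partial sum of `f` by `f 0 + ∑ h`. -/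
theorem summable_of_affine_recursion {f h : ℕ → ℝ} {t : ℝ} (hf : ∀ α, 0 ≤ f α)
    (hh : ∀ α, 0 ≤ h α) (hrec : ∀ α, f (α + 1) = t * f α + h α) (ht : t < 1)
    (hs : Summable h) : Summable f := by
  refine summable_of_sum_range_le (c := (f 0 + ∑' α, h α) / (1 - t)) hf fun N => ?_
  rw [le_div_iff₀ (by linarith)]
  have h1 : ∑ α ∈ Finset.range (N + 1), f α =
      t * ∑ α ∈ Finset.range N, f α + ∑ α ∈ Finset.range N, h α + f 0 := by
    rw [Finset.sum_range_succ', Finset.sum_congr rfl fun α _ => hrec α, Finset.sum_add_distrib,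
      Finset.mul_sum]
  have h2 := hs.sum_le_tsum (Finset.range N) fun α _ => hh α
  rw [Finset.sum_range_succ] at h1
  have := hf N
  linarith

variable [OrderTop P] {T : P → P → ℝ} {f : ℕ → P → ℝ}

/-- The limit at the top of the iterates of a triangular matrix with diagonal entry `1` at the top
and `< 1` elsewhere, as a sum over chains. -/
theorem tendsto_top_of_triangular (hT : ∀ x y, 0 ≤ T x y) (hle : ∀ x y, ¬ y ≤ x → T x y = 0)
    (h0 : ∀ x, f 0 x = 1) (hrec : ∀ α x, f (α + 1) x = ∑ y, T x y * f α y)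
    (htop : T ⊤ ⊤ = 1) (hlt : ∀ x, x ≠ ⊤ → T x x < 1) (N : ℕ)
    [∀ r, Fintype {c : Fin (r + 1) → P // c 0 = ⊤ ∧ StrictAnti c}]
    (hN : IsEmpty {c : Fin (N + 1) → P // c 0 = ⊤ ∧ StrictAnti c}) :
    Tendsto (fun α => f α ⊤) atTop (𝓝 (∑ r ∈ Finset.range N,
      ∑ c : {c : Fin (r + 1) → P // c 0 = ⊤ ∧ StrictAnti c},
        ∏ i : Fin r, T (c.1 i.castSucc) (c.1 i.succ) / (1 - T (c.1 i.succ) (c.1 i.succ)))) := by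
  classical
  -- The strictly triangular part of `T`; the diagonal is treated separately.
  let T' : P → P → ℝ := fun x y => if y < x then T x y else 0
  have hT' : ∀ x y, 0 ≤ T' x y := fun x y => by
    dsimp only [T']
    split_ifs
    exacts [hT x y, le_rfl]
  have hsplit : ∀ (x : P) (g : P → ℝ), ∑ y, T x y * g y = T x x * g x + ∑ y, T' x y * g y := by
    intro x g
    rw [← Finset.add_sum_erase _ _ (Finset.mem_univ x), ← Finset.add_sum_erase (f := fun y =>
      T' x y * g y) _ (Finset.mem_univ x)]
    have hx : T' x x = 0 := if_neg (lt_irrefl x)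
    rw [hx, zero_mul, zero_add]
    congr 1
    refine Finset.sum_congr rfl fun y hy => ?_
    have hne := Finset.ne_of_mem_erase hy
    by_cases hyx : y < x
    · simp only [T', if_pos hyx]
    · rw [hle x y fun h => hyx (lt_of_le_of_ne h hne)]
      simp only [T', if_neg hyx]
  have hf : ∀ α x, 0 ≤ f α x := by
    intro α
    induction α with
    | zero => intro x; rw [h0]; exact zero_le_one
    | succ α ih =>
      intro x
      rw [hrec]
      exact Finset.sum_nonneg fun y _ => mul_nonneg (hT x y) (ih y)
  have hrec' : ∀ x α, f (α + 1) x = T x x * f α x + ∑ y, T' x y * f α y := fun x α => by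
    rw [hrec, hsplit]
  have hsum' : ∀ x : P, (∀ y < x, Summable fun α => f α y) →
      Summable fun α => ∑ y, T' x y * f α y := by
    intro x hx
    refine summable_sum fun y _ => ?_
    by_cases hyx : y < x
    · exact (hx y hyx).mul_left _
    · simp [T', if_neg hyx]
  have hsum : ∀ x : P, x ≠ ⊤ → Summable fun α => f α x := by
    intro x
    induction x using WellFoundedLT.induction with
    | ind x ih =>
      intro hx
      exact summable_of_affine_recursion (fun α => hf α x)
        (fun α => Finset.sum_nonneg fun y _ => mul_nonneg (hT' x y) (hf α y)) (hrec' x)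
        (hlt x hx) (hsum' x fun y hy => ih y hy (hy.trans_le le_top).ne)
  have hsumT : ∀ x : P, Summable fun α => ∑ y, T' x y * f α y := fun x =>
    hsum' x fun y hy => hsum y (hy.trans_le le_top).ne
  let S : P → ℝ := fun x => ∑' α, f α x
  have htsum : ∀ x, ∑' α, ∑ y, T' x y * f α y = ∑ y, T' x y * S y := by
    intro x
    rw [Summable.tsum_finsetSum]
    · exact Finset.sum_congr rfl fun y _ => tsum_mul_left
    · intro y _
      by_cases hyx : y < x
      · exact (hsum y (hyx.trans_le le_top).ne).mul_left _
      · simp [T', if_neg hyx]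
  let h : P → ℝ := fun x => 1 + ∑ y, T' x y * S y
  have hS : ∀ x, x ≠ ⊤ → (1 - T x x) * S x = h x := by
    intro x hx
    have h1 := (hsum x hx).tsum_eq_zero_add
    rw [h0] at h1
    simp only [hrec' x] at h1
    rw [Summable.tsum_add ((hsum x hx).mul_left _) (hsumT x), tsum_mul_left, htsum] at h1
    change S x = _ at h1
    change _ = 1 + _
    change S x = 1 + (T x x * S x + _) at h1
    linarith
  -- Eliminating `S` through `(1 - T x x) * S x = h x` leaves the equation `h = 1 + U h` with `U`
  -- nilpotent; its Neumann series is the sum over chains.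
  let U : P → P → ℝ := fun x y => if y < x then T x y / (1 - T y y) else 0
  have hU : ∀ x y, ¬ y < x → U x y = 0 := fun x y hxy => if_neg hxy
  let Φ : (P → ℝ) → P → ℝ := fun g y => ∑ z, U y z * g z
  have hΦ : ∀ x, h x = 1 + Φ h x := by
    intro x
    refine congrArg (1 + ·) (Finset.sum_congr rfl fun y _ => ?_)
    by_cases hyx : y < x
    · have hy := (hyx.trans_le le_top).ne
      have hpos : 1 - T y y ≠ 0 := (sub_pos.2 (hlt y hy)).ne'
      simp only [T', U, if_pos hyx]
      rw [← hS y hy]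
      field_simp
    · simp only [T', U, if_neg hyx, zero_mul]
  have hiter : ∀ (r : ℕ) (x : P), h x = ∑ s ∈ Finset.range r, (Φ^[s] 1) x + (Φ^[r] h) x := by
    intro r
    induction r with
    | zero => simp
    | succ r ih =>
      intro x
      have hadd : ∀ (s : ℕ) (g g' : P → ℝ), Φ^[s] (g + g') = Φ^[s] g + Φ^[s] g' := by
        intro s
        induction s with
        | zero => intro g g'; rfl
        | succ s ihs =>
          intro g g'
          rw [Function.iterate_succ_apply, Function.iterate_succ_apply,
            Function.iterate_succ_apply, ← ihs]
          congr 1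
          ext y
          simp only [Φ, Pi.add_apply, mul_add, Finset.sum_add_distrib]
      have hh : h = 1 + Φ h := funext hΦ
      rw [ih x, Finset.sum_range_succ, Function.iterate_succ_apply, add_assoc]
      conv_lhs => rw [hh, hadd]
      rfl
  have hlim : h ⊤ = ∑ r ∈ Finset.range N,
      ∑ c : {c : Fin (r + 1) → P // c 0 = ⊤ ∧ StrictAnti c},
        ∏ i : Fin r, T (c.1 i.castSucc) (c.1 i.succ) / (1 - T (c.1 i.succ) (c.1 i.succ)) := by
    -- The remainder is a sum over chains of length `N` from the top, of which there are none.
    have hzero : (Φ^[N] h) ⊤ = 0 := by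
      rw [iterate_sum_mul_eq_sum_chain hU h N ⊤]
      exact Fintype.sum_empty _
    rw [hiter N ⊤, hzero, add_zero]
    refine Finset.sum_congr rfl fun r _ => ?_
    rw [iterate_sum_mul_eq_sum_chain hU 1 r ⊤]
    refine Finset.sum_congr rfl fun c _ => ?_
    rw [Pi.one_apply, mul_one]
    exact Finset.prod_congr rfl fun i _ => if_pos (c.2.2 i.castSucc_lt_succ)
  rw [← hlim]
  -- With diagonal entry 1 at the top, `f` there accumulates the contributions from below, so its
  -- limit is `h ⊤`.
  have hpart : ∀ N, f N ⊤ = 1 + ∑ α ∈ Finset.range N, ∑ y, T' ⊤ y * f α y := by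
    intro N
    induction N with
    | zero => simp [h0]
    | succ N ih => rw [hrec', htop, one_mul, ih, Finset.sum_range_succ, add_assoc]
  simp only [hpart, h, ← htsum]
  exact tendsto_const_nhds.add (hsumT ⊤).hasSum.tendsto_sum_nat

/-- In the first case the growth is geometric. In the second, `f` stays at least 1 at `x`, so the
top gains at least `T ⊤ x` at each step. -/
theorem tendsto_top_atTop_of_triangular (hT : ∀ x y, 0 ≤ T x y)
    (h0 : ∀ x, f 0 x = 1) (hrec : ∀ α x, f (α + 1) x = ∑ y, T x y * f α y)
    (h : 1 < T ⊤ ⊤ ∨ 1 ≤ T ⊤ ⊤ ∧ ∃ x, x ≠ ⊤ ∧ 1 ≤ T x x ∧ 0 < T ⊤ x) :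
    Tendsto (fun α => f α ⊤) atTop atTop := by
  classical
  have hf : ∀ α x, 0 ≤ f α x := by
    intro α
    induction α with
    | zero => intro x; rw [h0]; exact zero_le_one
    | succ α ih =>
      intro x
      rw [hrec]
      exact Finset.sum_nonneg fun y _ => mul_nonneg (hT x y) (ih y)
  rcases h with h | ⟨h1, x, hx, hxx, htx⟩
  · refine tendsto_atTop_mono (fun α => ?_) (tendsto_pow_atTop_atTop_of_one_lt h)
    induction α with
    | zero => rw [h0, pow_zero]
    | succ α ih =>
      rw [hrec, pow_succ']
      refine (mul_le_mul_of_nonneg_left ih (hT _ _)).trans ?_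
      exact Finset.single_le_sum (f := fun y => T ⊤ y * f α y)
        (fun y _ => mul_nonneg (hT _ _) (hf _ _)) (Finset.mem_univ _)
  · have hfx : ∀ α, 1 ≤ f α x := by
      intro α
      induction α with
      | zero => rw [h0]
      | succ α ih =>
        rw [hrec]
        refine (one_le_mul_of_one_le_of_one_le hxx ih).trans ?_
        exact Finset.single_le_sum (f := fun y => T x y * f α y)
          (fun y _ => mul_nonneg (hT _ _) (hf _ _)) (Finset.mem_univ _)
    refine tendsto_atTop_mono (fun α => ?_)
      (tendsto_natCast_atTop_atTop.atTop_mul_const htx : Tendsto (fun α : ℕ => (α : ℝ) * T ⊤ x) _ _)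
    induction α with
    | zero => simpa using hf 0 ⊤
    | succ α ih =>
      have h2 : ∑ y ∈ {⊤, x}, T ⊤ y * f α y ≤ f (α + 1) ⊤ := by
        rw [hrec]
        exact Finset.sum_le_sum_of_subset_of_nonneg (Finset.subset_univ _)
          fun y _ _ => mul_nonneg (hT _ _) (hf _ _)
      rw [Finset.sum_pair hx.symm] at h2
      have h3 := le_mul_of_one_le_left (hf α ⊤) h1
      have h4 := le_mul_of_one_le_right htx.le (hfx α)
      push_cast
      linarith

end

/-! ### Fourier inversion for the number of zeros of the moment map -/

section Fourier

theorem AddChar.map_finset_sum_eq_prod {A M ι : Type*} [AddCommMonoid A] [CommMonoid M]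
    (ψ : AddChar A M) (s : Finset ι) (g : ι → A) : ψ (∑ i ∈ s, g i) = ∏ i ∈ s, ψ (g i) := by
  classical
  induction s using Finset.induction_on with
  | empty => simp
  | insert i s hi ih => rw [Finset.sum_insert hi, Finset.prod_insert hi, ψ.map_add_eq_mul, ih]

variable {R : Type*} [CommRing R]

/-- The proportion of elements of a finite ring annihilated by `x`. -/
noncomputable def annWeight (x : R) : ℝ := (Nat.card {y : R // x * y = 0} : ℝ) / Nat.card R

/-- Multiplication by `x` has the annihilator as kernel and `xR` as image. Only the size of `xR`
matters, which makes weights at different levels comparable. -/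
theorem annWeight_eq_inv [Finite R] (x : R) :
    annWeight x = (Nat.card (Set.range fun y : R => x * y) : ℝ)⁻¹ := by
  have h := (AddMonoidHom.mulLeft x).ker.card_mul_index
  rw [AddSubgroup.index_ker] at h
  have h1 : Nat.card (AddMonoidHom.mulLeft x).ker = Nat.card {y : R // x * y = 0} := rfl
  have h2 : Nat.card (AddMonoidHom.mulLeft x).range = Nat.card (Set.range fun y : R => x * y) := rfl
  rw [h1, h2] at h
  have hpos : Nat.card R ≠ 0 := Nat.card_pos.ne'
  rw [← h] at hpos
  rw [annWeight, ← h, Nat.cast_mul, div_mul_cancel_left₀]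
  exact_mod_cast (mul_ne_zero_iff.1 hpos).1

theorem annWeight_of_isUnit [Finite R] {x : R} (hx : IsUnit x) :
    annWeight x = (Nat.card R : ℝ)⁻¹ := by
  have h : (Set.range fun y : R => x * y) = Set.univ :=
    Set.range_eq_univ.2 (IsUnit.isUnit_iff_mulLeft_bijective.1 hx).surjective
  rw [annWeight_eq_inv, h, Nat.card_univ]

variable [Fintype R] [DecidableEq R] {n m : ℕ} (a : Matrix (Fin n) (Fin m) ℤ)

/-- The triple character sum over ξ, `x`, `y` is evaluated in two ways. Summing over ξ detects the
zeros of the moment map; for fixed ξ the sum over `x`, `y` factors over the rows, with orthogonality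
in `x i` leaving the annihilator of the row value. -/
theorem momentZeroCount_mul_card_pow {ψ : AddChar R ℂ} (hψ : ψ.IsPrimitive) :
    momentZeroCount R a * Fintype.card R ^ m =
      ∑ ξ : Fin m → R, ∏ i, (Fintype.card R * Nat.card {y : R // a.rowForm R i ξ * y = 0}) := by
  have h1 : ∀ x y : Fin n → R,
      ∑ ξ : Fin m → R, ψ (∑ i, x i * (y i * a.rowForm R i ξ)) =
        if momentMap R a x y = 0 then (Fintype.card R : ℂ) ^ m else 0 := by
    intro x y
    have h : ∀ ξ : Fin m → R, ψ (∑ i, x i * (y i * a.rowForm R i ξ)) =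
        ∏ j, ψ (ξ j * momentMap R a x y j) := by
      intro ξ
      rw [← AddChar.map_finset_sum_eq_prod]
      congr 1
      simp only [Matrix.rowForm_apply, momentMap, Finset.mul_sum]
      rw [Finset.sum_comm]
      refine Finset.sum_congr rfl fun j _ => Finset.sum_congr rfl fun i _ => ?_
      ring
    rw [Finset.sum_congr rfl fun ξ _ => h ξ, ← Fintype.piFinset_univ,
      ← Finset.prod_univ_sum (fun _ => Finset.univ) fun j t => ψ (t * momentMap R a x y j),
      Finset.prod_congr rfl fun j _ => AddChar.sum_mulShift _ hψ]
    split_ifs with h0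
    · simp [h0]
    · obtain ⟨j, hj⟩ := Function.ne_iff.1 h0
      exact Finset.prod_eq_zero (Finset.mem_univ j) (by simpa using hj)
  have h2 : ∀ ξ : Fin m → R,
      ∑ x : Fin n → R, ∑ y : Fin n → R, ψ (∑ i, x i * (y i * a.rowForm R i ξ)) =
        ∏ i, ((Fintype.card R : ℂ) * Nat.card {y : R // a.rowForm R i ξ * y = 0}) := by
    intro ξ
    have h : ∀ i, ((Fintype.card R : ℂ) * Nat.card {y : R // a.rowForm R i ξ * y = 0}) =
        ∑ t, ∑ s, ψ (t * (s * a.rowForm R i ξ)) := by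
      intro i
      rw [Finset.sum_comm, Finset.sum_congr rfl fun s _ => AddChar.sum_mulShift _ hψ]
      rw [Nat.card_eq_fintype_card, Fintype.card_subtype, Finset.card_filter]
      push_cast
      rw [Finset.mul_sum]
      refine Finset.sum_congr rfl fun s _ => ?_
      simp [mul_comm s]
    rw [Finset.prod_congr rfl fun i _ => h i, Finset.prod_univ_sum, Fintype.piFinset_univ]
    refine Finset.sum_congr rfl fun x _ => ?_
    rw [Finset.prod_univ_sum, Fintype.piFinset_univ]
    refine Finset.sum_congr rfl fun y _ => ?_
    rw [AddChar.map_finset_sum_eq_prod]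
  have h3 : ((momentZeroCount R a * Fintype.card R ^ m : ℕ) : ℂ) =
      ((∑ ξ : Fin m → R,
        ∏ i, (Fintype.card R * Nat.card {y : R // a.rowForm R i ξ * y = 0}) : ℕ) : ℂ) := by
    push_cast
    rw [← Finset.sum_congr rfl fun ξ _ => h2 ξ, Finset.sum_comm,
      Finset.sum_congr rfl fun x _ => Finset.sum_comm,
      Finset.sum_congr rfl fun x _ => Finset.sum_congr rfl fun y _ => h1 x y,
      ← Fintype.sum_prod_type' fun x y => if momentMap R a x y = 0 then (Fintype.card R : ℂ) ^ m else 0,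
      momentZeroCount, Nat.card_eq_fintype_card, Fintype.card_subtype, Finset.card_filter]
    push_cast
    rw [Finset.sum_mul]
    simp
  exact_mod_cast h3

theorem momentZeroCount_div_card_zpow {ψ : AddChar R ℂ} (hψ : ψ.IsPrimitive) :
    (momentZeroCount R a : ℝ) / (Nat.card R : ℝ) ^ (2 * n - m : ℤ) =
      ∑ ξ : Fin m → R, ∏ i, annWeight (a.rowForm R i ξ) := by
  have h := congrArg (Nat.cast : ℕ → ℝ) (momentZeroCount_mul_card_pow a hψ)
  have hpos : (Nat.card R : ℝ) ≠ 0 := by exact_mod_cast Nat.card_pos.ne'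
  simp only [← Nat.card_eq_fintype_card (α := R)] at h
  push_cast at h
  have h' : ∀ ξ : Fin m → R, ∏ i,
      ((Nat.card R : ℝ) * Nat.card {y : R // a.rowForm R i ξ * y = 0}) =
        (Nat.card R : ℝ) ^ (2 * n) * ∏ i, annWeight (a.rowForm R i ξ) := by
    intro ξ
    rw [pow_mul, ← Fin.prod_const, ← Finset.prod_mul_distrib]
    refine Finset.prod_congr rfl fun i _ => ?_
    rw [annWeight]
    field_simp
  rw [Finset.sum_congr rfl fun ξ _ => h' ξ, ← Finset.mul_sum] at h
  rw [div_eq_iff (zpow_ne_zero _ hpos), zpow_sub₀ hpos]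
  rw [← mul_div_assoc, eq_div_iff (zpow_ne_zero _ hpos)]
  have e : (Nat.card R : ℝ) ^ (2 * n : ℤ) = (Nat.card R : ℝ) ^ (2 * n) := by
    exact_mod_cast rfl
  rw [e, zpow_natCast, h, mul_comm]

end Fourier

/-! ### The recursion in α over the quotients of a discrete valuation ring -/

/-- The rows on which `v` vanishes. -/
def Matrix.rowZeroSet {R : Type*} [CommRing R] {n m : ℕ} (a : Matrix (Fin n) (Fin m) ℤ)
    (v : Fin m → R) : Set (Fin n) :=
  {i | a.rowForm R i v = 0}

section DVR

open IsLocalRing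

variable {O : Type*} [CommRing O] [IsDomain O] [IsDiscreteValuationRing O]

theorem mem_maximalIdeal_pow_iff {ϖ : O} (hϖ : Irreducible ϖ) {α : ℕ} {x : O} :
    x ∈ maximalIdeal O ^ α ↔ ϖ ^ α ∣ x := by
  rw [hϖ.maximalIdeal_eq, Ideal.span_singleton_pow, Ideal.mem_span_singleton]

theorem card_quotient_maximalIdeal_pow (α : ℕ) :
    Nat.card (O ⧸ maximalIdeal O ^ α) = Nat.card (ResidueField O) ^ α :=
  cardQuot_pow_of_prime (P := maximalIdeal O) (IsDiscreteValuationRing.not_a_field O)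

theorem finite_quotient_maximalIdeal_pow [Finite (ResidueField O)] (α : ℕ) :
    Finite (O ⧸ maximalIdeal O ^ α) := by
  refine Nat.finite_of_card_ne_zero ?_
  rw [card_quotient_maximalIdeal_pow]
  exact pow_ne_zero _ Nat.card_pos.ne'

/-- Every nonzero element of `O/𝔪^(α+1)` has `ϖ^α` as a multiple, so a character nontrivial at `ϖ^α`
is primitive. The zero ring `O/𝔪^0` is treated apart. -/
theorem exists_isPrimitive_addChar [Finite (ResidueField O)] (α : ℕ) :
    ∃ ψ : AddChar (O ⧸ maximalIdeal O ^ α) ℂ, ψ.IsPrimitive := by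
  have := finite_quotient_maximalIdeal_pow (O := O) α
  obtain ⟨ϖ, hϖ⟩ := IsDiscreteValuationRing.exists_irreducible O
  rcases α with _ | α
  · refine ⟨1, fun x hx => absurd ?_ hx⟩
    obtain ⟨y, rfl⟩ := Ideal.Quotient.mk_surjective x
    exact Ideal.Quotient.eq_zero_iff_mem.2 (by simp)
  have hs : Ideal.Quotient.mk (maximalIdeal O ^ (α + 1)) (ϖ ^ α) ≠ 0 := by
    rw [Ne, Ideal.Quotient.eq_zero_iff_mem, mem_maximalIdeal_pow_iff hϖ,
      pow_dvd_pow_iff hϖ.ne_zero hϖ.not_isUnit]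
    omega
  obtain ⟨ψ, hψ⟩ := AddChar.exists_apply_ne_zero.2 hs
  refine ⟨ψ, fun x hx h1 => ?_⟩
  obtain ⟨y, rfl⟩ := Ideal.Quotient.mk_surjective x
  rw [Ne, Ideal.Quotient.eq_zero_iff_mem, mem_maximalIdeal_pow_iff hϖ] at hx
  obtain ⟨k, u, rfl⟩ := IsDiscreteValuationRing.eq_unit_mul_pow_irreducible
    (fun h : y = 0 => hx (h ▸ dvd_zero _)) hϖ
  have hk : k ≤ α := by
    by_contra hlt
    exact hx ((pow_dvd_pow ϖ (by omega)).mul_left _)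
  have h2 := DFunLike.congr_fun h1
    (Ideal.Quotient.mk (maximalIdeal O ^ (α + 1)) (((u⁻¹ : Oˣ) : O) * ϖ ^ (α - k)))
  rw [AddChar.mulShift_apply, ← map_mul, AddChar.one_apply] at h2
  have h3 : (u : O) * ϖ ^ k * (((u⁻¹ : Oˣ) : O) * ϖ ^ (α - k)) = ϖ ^ α := by
    rw [mul_mul_mul_comm, Units.mul_inv, one_mul, ← pow_add, Nat.add_sub_cancel' hk]
  rw [h3] at h2
  exact hψ h2

/-- Multiplication by a uniformizer as a map `O/𝔪^α → O/𝔪^(α+1)`. -/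
noncomputable def mulUniformizer {ϖ : O} (hϖ : Irreducible ϖ) (α : ℕ) :
    (O ⧸ maximalIdeal O ^ α) →ₗ[O] (O ⧸ maximalIdeal O ^ (α + 1)) :=
  Submodule.mapQ _ _ (LinearMap.mulLeft O ϖ) fun x hx => by
    change ϖ * x ∈ maximalIdeal O ^ (α + 1)
    rw [mem_maximalIdeal_pow_iff hϖ] at hx ⊢
    rw [pow_succ']
    exact mul_dvd_mul_left _ hx

theorem mulUniformizer_mk {ϖ : O} (hϖ : Irreducible ϖ) (α : ℕ) (x : O) :
    mulUniformizer hϖ α (Ideal.Quotient.mk _ x) = Ideal.Quotient.mk _ (ϖ * x) := rfl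

theorem mulUniformizer_injective {ϖ : O} (hϖ : Irreducible ϖ) (α : ℕ) :
    Function.Injective (mulUniformizer hϖ α) := by
  rw [injective_iff_map_eq_zero]
  intro x hx
  obtain ⟨y, rfl⟩ := Ideal.Quotient.mk_surjective x
  rw [mulUniformizer_mk, Ideal.Quotient.eq_zero_iff_mem, mem_maximalIdeal_pow_iff hϖ, pow_succ',
    mul_dvd_mul_iff_left hϖ.ne_zero] at hx
  rwa [Ideal.Quotient.eq_zero_iff_mem, mem_maximalIdeal_pow_iff hϖ]

theorem bijective_add_mulUniformizer {ϖ : O} (hϖ : Irreducible ϖ) (α : ℕ)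
    {m : ℕ} (s : (Fin m → ResidueField O) → Fin m → O) (hs : ∀ v j, residue O (s v j) = v j) :
    Function.Bijective fun (z : (Fin m → ResidueField O) × (Fin m → O ⧸ maximalIdeal O ^ α)) =>
      fun j => Ideal.Quotient.mk (maximalIdeal O ^ (α + 1)) (s z.1 j) +
        mulUniformizer hϖ α (z.2 j) := by
  constructor
  · rintro ⟨v, η⟩ ⟨v', η'⟩ h
    have hv : v = v' := by
      ext j
      obtain ⟨y, hy⟩ := Ideal.Quotient.mk_surjective (η j)
      obtain ⟨y', hy'⟩ := Ideal.Quotient.mk_surjective (η' j)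
      have hj := congrFun h j
      simp only [← hy, ← hy', mulUniformizer_mk, ← map_add] at hj
      rw [Ideal.Quotient.eq] at hj
      have hj' := Ideal.pow_le_self (Nat.succ_ne_zero α) hj
      have hϖ0 : residue O ϖ = 0 := by
        rw [residue_eq_zero_iff]
        exact hϖ.not_isUnit
      rw [← residue_eq_zero_iff] at hj'
      simp only [map_sub, map_add, map_mul, hs, hϖ0, zero_mul, add_zero] at hj'
      exact sub_eq_zero.1 hj'
    subst hv
    congr 1
    ext j
    exact mulUniformizer_injective hϖ α (add_left_cancel (congrFun h j))
  · intro ξ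
    choose y hy using fun j => Ideal.Quotient.mk_surjective (ξ j)
    have hdvd : ∀ j, ϖ ∣ y j - s (fun j => residue O (y j)) j := by
      intro j
      rw [← pow_one ϖ, ← mem_maximalIdeal_pow_iff hϖ, pow_one, ← residue_eq_zero_iff, map_sub, hs,
        sub_self]
    choose w hw using hdvd
    refine ⟨⟨fun j => residue O (y j), fun j => Ideal.Quotient.mk _ (w j)⟩, ?_⟩
    ext j
    simp only [mulUniformizer_mk, ← map_add, ← hw]
    rw [add_sub_cancel, hy]

theorem rowForm_mulUniformizer {ϖ : O} (hϖ : Irreducible ϖ) (α : ℕ)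
    {n m : ℕ} (a : Matrix (Fin n) (Fin m) ℤ) (i : Fin n)
    (η : Fin m → O ⧸ maximalIdeal O ^ α) :
    a.rowForm _ i (fun j => mulUniformizer hϖ α (η j)) =
      mulUniformizer hϖ α (a.rowForm _ i η) := by
  simp only [Matrix.rowForm_apply, map_sum, ← zsmul_eq_mul, map_zsmul]

variable [Finite (ResidueField O)]

/-- Multiplication by `ϖ` maps the ideal generated by `x` bijectively onto the ideal generated by
its image one level up. -/
theorem annWeight_mulUniformizer {ϖ : O} (hϖ : Irreducible ϖ) (α : ℕ)
    (x : O ⧸ maximalIdeal O ^ α) : annWeight (mulUniformizer hϖ α x) = annWeight x := by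
  have := finite_quotient_maximalIdeal_pow (O := O) α
  have := finite_quotient_maximalIdeal_pow (O := O) (α + 1)
  obtain ⟨z, rfl⟩ := Ideal.Quotient.mk_surjective x
  rw [annWeight_eq_inv, annWeight_eq_inv]
  have h : (Set.range fun y => mulUniformizer hϖ α (Ideal.Quotient.mk _ z) * y) =
      mulUniformizer hϖ α '' Set.range fun y => Ideal.Quotient.mk _ z * y := by
    ext w
    constructor
    · rintro ⟨y, rfl⟩
      obtain ⟨y, rfl⟩ := Ideal.Quotient.mk_surjective y
      refine ⟨_, ⟨Ideal.Quotient.mk _ y, rfl⟩, ?_⟩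
      dsimp only
      rw [mulUniformizer_mk, ← map_mul, ← map_mul, mulUniformizer_mk, mul_assoc]
    · rintro ⟨_, ⟨y, rfl⟩, rfl⟩
      obtain ⟨y, rfl⟩ := Ideal.Quotient.mk_surjective y
      refine ⟨Ideal.Quotient.mk _ y, ?_⟩
      dsimp only
      rw [mulUniformizer_mk, ← map_mul, ← map_mul, mulUniformizer_mk, mul_assoc]
  rw [h, Nat.card_image_of_injective (mulUniformizer_injective hϖ α)]

theorem annWeight_one_quotient (α : ℕ) : annWeight (1 : O ⧸ maximalIdeal O ^ α) =
    ((Nat.card (ResidueField O) : ℝ) ^ α)⁻¹ := by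
  have := finite_quotient_maximalIdeal_pow (O := O) α
  rw [annWeight_of_isUnit isUnit_one, card_quotient_maximalIdeal_pow, Nat.cast_pow]

variable [∀ α, Fintype (O ⧸ maximalIdeal O ^ α)] [Fintype (ResidueField O)]
  {n m : ℕ} (a : Matrix (Fin n) (Fin m) ℤ)

variable (O) in
open Classical in
/-- The sum over `(O/𝔪^α)^m` of the products of the weights of the rows in `I` and of the weights
of units for the remaining rows. -/
noncomputable def weightSum (α : ℕ) (I : Set (Fin n)) : ℝ :=
  ∑ ξ : Fin m → O ⧸ maximalIdeal O ^ α,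
    ∏ i, annWeight (if i ∈ I then a.rowForm (O ⧸ maximalIdeal O ^ α) i ξ else 1)

variable (O) in
theorem weightSum_zero (I : Set (Fin n)) : weightSum O a 0 I = 1 := by
  have hsub : Subsingleton (O ⧸ maximalIdeal O ^ 0) := by
    rw [pow_zero, Ideal.one_eq_top]
    infer_instance
  have h : ∀ x : O ⧸ maximalIdeal O ^ 0, annWeight x = 1 := fun x => by
    rw [Subsingleton.elim x 1, annWeight_one_quotient]
    simp
  simp [weightSum, h]

-- Split ξ into its residue `v` and a remainder `ϖη`. Rows of `I` vanishing at `v` pass to level α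
-- with unchanged weight; all others contribute units and a factor 1/q.
open Classical in
theorem weightSum_succ (ha : a.UnitMinors O) (α : ℕ) (I : Set (Fin n)) :
    weightSum O a (α + 1) I = ∑ v : Fin m → ResidueField O,
      (∏ i, if i ∈ I ∩ a.rowZeroSet v then (1 : ℝ) else (Nat.card (ResidueField O) : ℝ)⁻¹) *
        weightSum O a α (I ∩ a.rowZeroSet v) := by
  obtain ⟨ϖ, hϖ⟩ := IsDiscreteValuationRing.exists_irreducible O
  -- This is where invertibility of the minors enters: the lift of `v` annihilates exactly, not just
  -- modulo `ϖ`, the rows of `I` that vanish at `v`.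
  have hlift : ∀ v : Fin m → ResidueField O, ∃ w : Fin m → O,
      w ∈ a.rowZeros O (I ∩ a.rowZeroSet v) ∧ ∀ j, residue O (w j) = v j := fun v =>
    a.exists_lift_rowZeros (residue O) residue_surjective ha _
      (Matrix.mem_rowZeros.2 fun i hi => hi.2)
  choose s hs0 hs using hlift
  rw [weightSum, ← (Equiv.ofBijective _ (bijective_add_mulUniformizer hϖ α s hs)).sum_comp,
    Fintype.sum_prod_type]
  refine Finset.sum_congr rfl fun v _ => ?_
  rw [weightSum, Finset.mul_sum]
  refine Finset.sum_congr rfl fun η _ => ?_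
  rw [← Finset.prod_mul_distrib]
  refine Finset.prod_congr rfl fun i _ => ?_
  have := finite_quotient_maximalIdeal_pow (O := O) (α + 1)
  have hunit : ∀ x : O ⧸ maximalIdeal O ^ (α + 1), IsUnit x → annWeight x =
      (Nat.card (ResidueField O) : ℝ)⁻¹ * annWeight (1 : O ⧸ maximalIdeal O ^ α) := by
    intro x hx
    rw [annWeight_of_isUnit hx, card_quotient_maximalIdeal_pow, annWeight_one_quotient,
      Nat.cast_pow, pow_succ', mul_inv]
  have hform : a.rowForm (O ⧸ maximalIdeal O ^ (α + 1)) i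
      ((Equiv.ofBijective _ (bijective_add_mulUniformizer hϖ α s hs)) (v, η)) =
        Ideal.Quotient.mk _ (a.rowForm O i (s v)) + mulUniformizer hϖ α (a.rowForm _ i η) := by
    rw [← rowForm_mulUniformizer, Matrix.map_rowForm, ← map_add]
    rfl
  by_cases hi : i ∈ I
  · rw [if_pos hi, hform]
    by_cases hv : i ∈ a.rowZeroSet v
    · rw [if_pos ⟨hi, hv⟩, if_pos ⟨hi, hv⟩, Matrix.mem_rowZeros.1 (hs0 v) i ⟨hi, hv⟩, map_zero,
        zero_add, one_mul, annWeight_mulUniformizer]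
    · rw [if_neg fun h => hv h.2, if_neg fun h => hv h.2]
      refine hunit _ ?_
      obtain ⟨y, hy⟩ := Ideal.Quotient.mk_surjective (a.rowForm _ i η)
      rw [← hy, mulUniformizer_mk, ← map_add]
      refine IsUnit.map _ ?_
      rw [← residue_ne_zero_iff_isUnit, map_add, map_mul, Matrix.map_rowForm]
      have hϖ0 : residue O ϖ = 0 := by
        rw [residue_eq_zero_iff]
        exact hϖ.not_isUnit
      simp only [hs, hϖ0, zero_mul, add_zero]
      exact hv
  · rw [if_neg hi, if_neg fun h => hi h.1, if_neg fun h => hi h.1]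
    exact hunit _ isUnit_one

end DVR

/-! ### Coloop-freeness as a dimension bound, and index sets of subquotients -/

namespace CentralArrangement

section

variable {k V ι : Type*} [Field k] [AddCommGroup V] [Module k V] [FiniteDimensional k V]
  (A : CentralArrangement k V ι)

theorem normal_mem_span_iff {S : Set ι} {i : ι} :
    A.normal i ∈ Submodule.span k (A.normal '' S) ↔ A.inter S ≤ A.hyperplane i := by
  constructor
  · intro h v hv
    have hle : Submodule.span k (A.normal '' S) ≤
        LinearMap.ker (LinearMap.applyₗ v : Module.Dual k V →ₗ[k] k) := by
      rw [Submodule.span_le]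
      rintro _ ⟨j, hj, rfl⟩
      exact A.mem_inter.1 hv j hj
    exact hle h
  · intro h
    have hcomap : ((Submodule.span k (A.normal '' S)).dualCoannihilator) ≤ A.hyperplane i := by
      refine le_trans (fun v hv => A.mem_inter.2 fun j hj => ?_) h
      exact (Submodule.mem_dualCoannihilator _).1 hv _ (Submodule.subset_span ⟨j, hj, rfl⟩)
    rw [← Subspace.dualCoannihilator_dualAnnihilator_eq (W := Submodule.span k (A.normal '' S)),
      Submodule.mem_dualAnnihilator]
    exact fun v hv => hcomap hv

theorem isColoopFree_iff : A.IsColoopFree ↔ ∀ i, A.inter {j | j ≠ i} ≤ A.hyperplane i :=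
  forall_congr' fun _ => A.normal_mem_span_iff

/-- In an essential and coloop-free arrangement, each intersection of hyperplanes other than the
intersection of all of them has dimension less than the number of hyperplanes left out. -/
theorem finrank_inter_add_ncard_lt [Finite ι] (hess : A.IsEssential) (hcol : A.IsColoopFree)
    {I : Set ι} (hI : I ≠ Set.univ) : Module.finrank k (A.inter I) + I.ncard < Nat.card ι := by
  classical
  have := Fintype.ofFinite ι
  obtain ⟨i, hi⟩ := (Set.ne_univ_iff_exists_notMem I).1 hI
  -- One index `i` outside `I` can be dropped: if the other normals vanish at a vector,
  -- coloop-freeness gives the `i`-th, and essentiality makes the vector zero. This makes the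
  -- inequality strict.
  let Φ : A.inter I →ₗ[k] ({j // j ∉ insert i I} → k) :=
    (LinearMap.pi fun j => A.normal j.1).domRestrict (A.inter I)
  have hΦ : Function.Injective Φ := by
    rw [injective_iff_map_eq_zero]
    intro v hv
    have hj : ∀ j, j ≠ i → A.normal j v.1 = 0 := by
      intro j hji
      by_cases hjI : j ∈ I
      · exact A.mem_inter.1 v.2 j hjI
      · exact congrFun hv ⟨j, fun h => h.elim hji hjI⟩
    have hi0 : A.normal i v.1 = 0 := A.isColoopFree_iff.1 hcol i (A.mem_inter.2 hj)
    have hbot : v.1 ∈ A.inter Set.univ := A.mem_inter.2 fun j _ => by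
      by_cases hji : j = i
      · rw [hji, hi0]
      · exact hj j hji
    rw [A.isEssential_iff_inter_univ.1 hess, Submodule.mem_bot] at hbot
    exact Subtype.ext hbot
  have h1 := LinearMap.finrank_le_finrank_of_injective hΦ
  rw [Module.finrank_fintype_fun_eq_card, ← Nat.card_eq_fintype_card] at h1
  have h2 := Set.ncard_add_ncard_compl (insert i I)
  rw [Set.ncard_insert_of_notMem hi] at h2
  have h3 : Nat.card {j // j ∉ insert i I} = (insert i I)ᶜ.ncard := rfl
  omega

end

section

variable {k V ι : Type*} [Field k] [AddCommGroup V] [Module k V] {A : CentralArrangement k V ι}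

theorem mem_unionSubquotient_iff {I J : Set ι} {K : Set {j : J // j ∉ {j : J | j.1 ∈ I}}}
    (j : {j : J // j ∉ {j : J | j.1 ∈ I}}) : j.1.1 ∈ unionSubquotient I J K ↔ j ∈ K := by
  constructor
  · rintro (h | ⟨j', hj', h⟩)
    · exact absurd h j.2
    · rwa [← Subtype.ext (Subtype.ext h)]
  · exact fun h => Or.inr ⟨j, h, rfl⟩

theorem unionSubquotient_subset_iff {I J : Set ι}
    {K L : Set {j : J // j ∉ {j : J | j.1 ∈ I}}} :
    unionSubquotient I J K ⊆ unionSubquotient I J L ↔ K ⊆ L := by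
  constructor
  · exact fun h j hj => (mem_unionSubquotient_iff j).1 (h ((mem_unionSubquotient_iff j).2 hj))
  · rintro h i (hi | ⟨j, hj, rfl⟩)
    · exact Or.inl hi
    · exact Or.inr ⟨j, h hj, rfl⟩

theorem exists_unionSubquotient_eq {I J S : Set ι} (hIS : I ⊆ S) (hSJ : S ⊆ J) :
    ∃ K, unionSubquotient I J K = S := by
  refine ⟨{j | j.1.1 ∈ S}, Set.Subset.antisymm ?_ fun i hi => ?_⟩
  · rintro i (hi | ⟨j, hj, rfl⟩)
    exacts [hIS hi, hj]
  · by_cases hiI : i ∈ I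
    · exact Or.inl hiI
    · exact Or.inr ⟨⟨⟨i, hSJ hi⟩, hiI⟩, hi, rfl⟩

end

end CentralArrangement

/-! ### Counting residue-field points by their vanishing rows -/

section Count

open CentralArrangement

variable {F κ : Type*} [Field F] [Field κ] {n m : ℕ} {a : Matrix (Fin n) (Fin m) ℤ}
  (ha : ∀ i, ∃ j, (a i j : F) ≠ 0)

theorem inter_rowArrangement (S : Set (Fin n)) :
    (a.rowArrangement F ha).inter S = a.rowZeros F S := by
  ext v
  rw [mem_inter, Matrix.mem_rowZeros]
  rfl

theorem finrank_rowZeros_eq_inter (hF : a.UnitMinors F) (hκ : a.UnitMinors κ)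
    (S : Set (Fin n)) :
    Module.finrank κ (a.rowZeros κ S) =
      Module.finrank F ((a.rowArrangement F ha).inter S) := by
  rw [inter_rowArrangement, a.finrank_rowZeros_eq κ F hκ hF]

theorem card_rowZeros (hF : a.UnitMinors F) (hκ : a.UnitMinors κ)
    (S : Set (Fin n)) :
    Nat.card (a.rowZeros κ S) =
      Nat.card κ ^ Module.finrank F ((a.rowArrangement F ha).inter S) := by
  rw [← finrank_rowZeros_eq_inter ha hF hκ, Module.natCard_eq_pow_finrank (K := κ)]

/-- Flats are taken over `F` while `v` lives over `κ`. Adjoining a row that leaves the intersection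
over `F` unchanged also preserves the dimension of the zero space over `κ`, so that row vanishes at
`v`. -/
theorem isFlat_inter_rowZeroSet (hF : a.UnitMinors F) (hκ : a.UnitMinors κ)
    {I : Set (Fin n)} (hI : (a.rowArrangement F ha).IsFlat I)
    (v : Fin m → κ) : (a.rowArrangement F ha).IsFlat (I ∩ a.rowZeroSet v) := by
  rw [isFlat_iff] at hI ⊢
  intro i hi
  refine ⟨hI i (le_trans (inter_anti _ Set.inter_subset_left) hi), ?_⟩
  have heq : (a.rowArrangement F ha).inter (insert i (I ∩ a.rowZeroSet v)) =
      (a.rowArrangement F ha).inter (I ∩ a.rowZeroSet v) := by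
    refine le_antisymm (inter_anti _ (Set.subset_insert _ _)) fun w hw => ?_
    rw [mem_inter]
    rintro j (rfl | hj)
    · exact hi hw
    · exact (mem_inter _).1 hw j hj
  have hle : a.rowZeros κ (insert i (I ∩ a.rowZeroSet v)) ≤
      a.rowZeros κ (I ∩ a.rowZeroSet v) := fun w hw =>
    Matrix.mem_rowZeros.2 fun j hj => Matrix.mem_rowZeros.1 hw j (Set.mem_insert_of_mem _ hj)
  have h := Submodule.eq_of_le_of_finrank_eq hle (by
    rw [finrank_rowZeros_eq_inter ha hF hκ, finrank_rowZeros_eq_inter ha hF hκ, heq])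
  have hv : v ∈ a.rowZeros κ (I ∩ a.rowZeroSet v) := Matrix.mem_rowZeros.2 fun j hj => hj.2
  rw [← h] at hv
  exact Matrix.mem_rowZeros.1 hv i (Set.mem_insert _ _)

variable [Fintype κ]

/-- The characteristic polynomial of `A_J^I` counts the points over a finite field whose set of
vanishing rows within `J` is `I`. -/
theorem card_stratum (hF : a.UnitMinors F) (hκ : a.UnitMinors κ)
    (I J : (a.rowArrangement F ha).Flat) (hIJ : I ≤ J) :
    (Nat.card {v : Fin m → κ // J.1 ∩ a.rowZeroSet v = I.1} : ℤ) =
      (Nat.card κ : ℤ) ^ Module.finrank F ((a.rowArrangement F ha).inter J.1) *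
        ((a.rowArrangement F ha).subquotient I J hIJ).charPoly.eval (Nat.card κ : ℤ) := by
  classical
  have key := eval_charPoly_eq ((a.rowArrangement F ha).subquotient I J hIJ) (Nat.card κ : ℤ)
    ((Nat.card κ : ℤ) ^ Module.finrank F ((a.rowArrangement F ha).inter J.1))
    (fun K => (Nat.card {v : Fin m → κ //
      J.1 ∩ a.rowZeroSet v = unionSubquotient I.1 J.1 K.1} : ℤ)) ?_
  · rw [key]
    have hempty : unionSubquotient I.1 J.1
        ((a.rowArrangement F ha).subquotient I J hIJ).emptyFlat.1 = I.1 := by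
      refine Set.Subset.antisymm ?_ fun i hi => Or.inl hi
      rintro i (hi | ⟨j, hj, -⟩)
      exacts [hi, hj.elim]
    rw [hempty]
  intro K
  have hcard : (Nat.card κ : ℤ) ^ Module.finrank F ((a.rowArrangement F ha).inter J.1) *
      (Nat.card κ : ℤ) ^ ((a.rowArrangement F ha).subquotient I J hIJ).corank K.1 =
        (Nat.card (a.rowZeros κ (unionSubquotient I.1 J.1 K.1)) : ℤ) := by
    rw [card_rowZeros ha hF hκ, ← (a.rowArrangement F ha).corank_subquotient_add I J hIJ K.1,
      Nat.cast_pow, add_comm, pow_add]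
  rw [hcard]
  have hsub : ∀ (p : (Fin m → κ) → Prop),
      (Nat.card {v // p v} : ℤ) = ∑ v, if p v then 1 else 0 := by
    intro p
    rw [Nat.card_eq_fintype_card, Fintype.card_subtype, Finset.card_filter]
    push_cast
    rfl
  have h1 : (Nat.card (a.rowZeros κ (unionSubquotient I.1 J.1 K.1)) : ℤ) =
      ∑ v : Fin m → κ, if v ∈ a.rowZeros κ (unionSubquotient I.1 J.1 K.1) then 1 else 0 :=
    hsub fun v => v ∈ a.rowZeros κ (unionSubquotient I.1 J.1 K.1)
  rw [h1]
  have h2 : ∀ K' : ((a.rowArrangement F ha).subquotient I J hIJ).Flat,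
      (if K ≤ K' then (Nat.card {v : Fin m → κ //
        J.1 ∩ a.rowZeroSet v = unionSubquotient I.1 J.1 K'.1} : ℤ) else 0) =
      ∑ v : Fin m → κ, if K ≤ K' ∧ J.1 ∩ a.rowZeroSet v = unionSubquotient I.1 J.1 K'.1
        then 1 else 0 := by
    intro K'
    rw [hsub]
    by_cases h : K ≤ K'
    · rw [if_pos h]
      exact Finset.sum_congr rfl fun v _ => if_congr (by simp [h]) rfl rfl
    · rw [if_neg h]
      exact (Finset.sum_eq_zero fun v _ => if_neg fun h' => h h'.1).symm
  -- It remains to see that each common zero `v` lies in exactly one stratum `K' ≥ K`, namely that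
  -- of its vanishing rows in `J`, and that other vectors lie in none.
  rw [Finset.sum_congr rfl fun K' _ => h2 K', Finset.sum_comm]
  refine Finset.sum_congr rfl fun v _ => ?_
  have hUJ : unionSubquotient I.1 J.1 K.1 ⊆ J.1 := by
    rintro i (hi | ⟨j, -, rfl⟩)
    exacts [hIJ hi, j.1.2]
  split_ifs with hv
  · have hvU : unionSubquotient I.1 J.1 K.1 ⊆ J.1 ∩ a.rowZeroSet v := fun i hi =>
      ⟨hUJ hi, Matrix.mem_rowZeros.1 hv i hi⟩
    obtain ⟨L, hL⟩ := exists_unionSubquotient_eq (I := I.1) (J := J.1)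
      (S := J.1 ∩ a.rowZeroSet v) (fun i hi => hvU (Or.inl hi)) Set.inter_subset_left
    have hLflat := ((a.rowArrangement F ha).isFlat_subquotient_iff I J hIJ L).2
      (hL ▸ isFlat_inter_rowZeroSet ha hF hκ J.2 v)
    have hKL : K.1 ⊆ L := unionSubquotient_subset_iff.1 (hL ▸ hvU)
    rw [Finset.sum_eq_single (⟨L, hLflat⟩ : ((a.rowArrangement F ha).subquotient I J hIJ).Flat)]
    · exact if_pos ⟨hKL, hL.symm⟩
    · intro K' _ hne
      refine if_neg fun h => hne (Subtype.ext ?_)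
      have he : unionSubquotient I.1 J.1 L = unionSubquotient I.1 J.1 K'.1 := hL.trans h.2
      exact Set.Subset.antisymm (unionSubquotient_subset_iff.1 he.ge)
        (unionSubquotient_subset_iff.1 he.le)
    · exact fun h => absurd (Finset.mem_univ _) h
  · refine Finset.sum_eq_zero fun K' _ => if_neg fun h => hv (Matrix.mem_rowZeros.2 fun i hi => ?_)
    have hi' : i ∈ J.1 ∩ a.rowZeroSet v := h.2 ▸ unionSubquotient_subset_iff.2 h.1 hi
    exact hi'.2

end Count

/-! ### The transition matrix between flats -/

section Transition

open CentralArrangement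

variable {F κ : Type*} [Field F] [Field κ] {n m : ℕ} {a : Matrix (Fin n) (Fin m) ℤ}
  (ha : ∀ i, ∃ j, (a i j : F) ≠ 0)

variable (κ) in
/-- The transition matrix between flats for the recursion of the weighted sums. -/
noncomputable def flatTransition (J I : (a.rowArrangement F ha).Flat) : ℝ :=
  (Nat.card {v : Fin m → κ // J.1 ∩ a.rowZeroSet v = I.1} : ℝ) *
    (Nat.card κ : ℝ) ^ ((I.1.ncard : ℤ) - n)

theorem flatTransition_nonneg (J I : (a.rowArrangement F ha).Flat) :
    0 ≤ flatTransition κ ha J I := by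
  unfold flatTransition
  positivity

theorem flatTransition_of_not_le (J I : (a.rowArrangement F ha).Flat) (h : ¬ I ≤ J) :
    flatTransition κ ha J I = 0 := by
  have : IsEmpty {v : Fin m → κ // J.1 ∩ a.rowZeroSet v = I.1} :=
    ⟨fun v => h (v.2.symm.subset.trans Set.inter_subset_left : I.1 ⊆ J.1)⟩
  simp [flatTransition]

variable [Fintype κ]

theorem flatTransition_self (hF : a.UnitMinors F) (hκ : a.UnitMinors κ)
    (I : (a.rowArrangement F ha).Flat) :
    flatTransition κ ha I I = (Nat.card κ : ℝ) ^
      ((Module.finrank F ((a.rowArrangement F ha).inter I.1) : ℤ) + I.1.ncard - n) := by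
  have hq : (Nat.card κ : ℝ) ≠ 0 := by exact_mod_cast Nat.card_pos.ne'
  have h : Nat.card {v : Fin m → κ // I.1 ∩ a.rowZeroSet v = I.1} =
      Nat.card (a.rowZeros κ I.1) := by
    refine Nat.card_congr (Equiv.subtypeEquivRight fun v => ?_)
    rw [Set.inter_eq_left, Matrix.mem_rowZeros]
    rfl
  rw [flatTransition, h, card_rowZeros ha hF hκ, add_sub_assoc, zpow_add₀ hq, zpow_natCast,
    Nat.cast_pow]

theorem delta_sub_eq (I : (a.rowArrangement F ha).Flat) :
    (a.rowArrangement F ha).delta I.1 - m =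
      n - I.1.ncard - Module.finrank F ((a.rowArrangement F ha).inter I.1) := by
  have h := (a.rowArrangement F ha).rank_localization_add I.1
  rw [Module.finrank_fin_fun] at h
  rw [delta, Nat.card_fin]
  omega

theorem flatTransition_div (hF : a.UnitMinors F) (hκ : a.UnitMinors κ)
    (I J : (a.rowArrangement F ha).Flat) (hIJ : I ≤ J) :
    flatTransition κ ha J I / (1 - flatTransition κ ha I I) =
      ((Nat.card κ : ℝ) ^ Module.finrank F ((a.rowArrangement F ha).inter J.1) /
        (Nat.card κ : ℝ) ^ Module.finrank F ((a.rowArrangement F ha).inter I.1)) *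
      (((((a.rowArrangement F ha).subquotient I J hIJ).charPoly.eval
        (Nat.card κ : ℤ) : ℤ) : ℝ) /
          ((Nat.card κ : ℝ) ^ ((a.rowArrangement F ha).delta I.1 - m) - 1)) := by
  have hq : (Nat.card κ : ℝ) ≠ 0 := by exact_mod_cast Nat.card_pos.ne'
  have h := congrArg (Int.cast : ℤ → ℝ) (card_stratum ha hF hκ I J hIJ)
  push_cast at h
  rw [flatTransition_self ha hF hκ, delta_sub_eq, flatTransition, h]
  set d := Module.finrank F ((a.rowArrangement F ha).inter I.1)
  have e1 : (I.1.ncard : ℤ) - n = -(n - I.1.ncard - d) - d := by ring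
  have e2 : (d : ℤ) + I.1.ncard - n = -(n - I.1.ncard - d) := by ring
  rw [e1, e2, zpow_sub₀ hq, zpow_neg, zpow_natCast]
  have hx : (Nat.card κ : ℝ) ^ ((n : ℤ) - I.1.ncard - d) ≠ 0 := zpow_ne_zero _ hq
  generalize (Nat.card κ : ℝ) ^ ((n : ℤ) - I.1.ncard - d) = x at hx
  have e3 : 1 - x⁻¹ = (x - 1) * x⁻¹ := by rw [sub_mul, mul_inv_cancel₀ hx, one_mul]
  rw [e3]
  have hd : (Nat.card κ : ℝ) ^ d ≠ 0 := pow_ne_zero _ hq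
  -- Here `x` is `q^(δ_I - m)`, the inverse of the diagonal entry. For `x = 1` both sides are 0, as
  -- division by zero gives 0.
  by_cases hx1 : x - 1 = 0
  · simp [hx1]
  · field_simp

open Classical in
theorem sum_rowZeroSet_eq_sum_flat (hF : a.UnitMinors F) (hκ : a.UnitMinors κ)
    (J : (a.rowArrangement F ha).Flat) (g : Set (Fin n) → ℝ) :
    (∑ v : Fin m → κ, (∏ i, if i ∈ J.1 ∩ a.rowZeroSet v then (1 : ℝ) else (Nat.card κ : ℝ)⁻¹) *
      g (J.1 ∩ a.rowZeroSet v)) = ∑ I, flatTransition κ ha J I * g I.1 := by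
  have hq : (Nat.card κ : ℝ) ≠ 0 := by exact_mod_cast Nat.card_pos.ne'
  have hprod : ∀ (S : Set (Fin n)) [DecidablePred (· ∈ S)],
      (∏ i, if i ∈ S then (1 : ℝ) else (Nat.card κ : ℝ)⁻¹) =
      (Nat.card κ : ℝ) ^ ((S.ncard : ℤ) - n) := by
    intro S _
    have h1 := Set.ncard_add_ncard_compl S
    have h2 : (Sᶜ).ncard = (Finset.univ.filter fun i => i ∉ S).card := by
      rw [← Set.ncard_coe_finset]
      congr 1
      ext
      simp
    rw [Nat.card_fin] at h1
    rw [Finset.prod_ite, Finset.prod_const_one, one_mul, Finset.prod_const, ← h2, inv_pow,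
      ← zpow_natCast, ← zpow_neg]
    congr 1
    omega
  rw [← Finset.sum_fiberwise Finset.univ fun v : Fin m → κ =>
    (⟨J.1 ∩ a.rowZeroSet v, isFlat_inter_rowZeroSet ha hF hκ J.2 v⟩ :
      (a.rowArrangement F ha).Flat)]
  refine Finset.sum_congr rfl fun I _ => ?_
  have hI : ∀ v : Fin m → κ, (⟨J.1 ∩ a.rowZeroSet v, isFlat_inter_rowZeroSet ha hF hκ J.2 v⟩ :
      (a.rowArrangement F ha).Flat) = I ↔ J.1 ∩ a.rowZeroSet v = I.1 := fun v => Subtype.ext_iff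
  simp only [hI]
  have hterm : ∀ v ∈ Finset.univ.filter (fun v : Fin m → κ => J.1 ∩ a.rowZeroSet v = I.1),
      (∏ i, if i ∈ J.1 ∩ a.rowZeroSet v then (1 : ℝ) else (Nat.card κ : ℝ)⁻¹) *
        g (J.1 ∩ a.rowZeroSet v) = (Nat.card κ : ℝ) ^ ((I.1.ncard : ℤ) - n) * g I.1 := by
    intro v hv
    rw [hprod, (Finset.mem_filter.1 hv).2]
  rw [Finset.sum_congr rfl hterm, Finset.sum_const, nsmul_eq_mul, flatTransition,
    Nat.card_eq_fintype_card (α := {v : Fin m → κ // J.1 ∩ a.rowZeroSet v = I.1}),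
    Fintype.card_subtype, mul_assoc]

/-- Without essentiality the top entry is a positive power of `q`. For a coloop `i`, the complement
of `i` is a flat of `n - 1` indices with nonzero intersection, so its diagonal entry is at least 1.
-/
theorem diverging_entries (hF : a.UnitMinors F) (hκ : a.UnitMinors κ)
    (h : ¬ ((a.rowArrangement F ha).IsEssential ∧ (a.rowArrangement F ha).IsColoopFree)) :
    1 < flatTransition κ ha ⊤ ⊤ ∨ 1 ≤ flatTransition κ ha ⊤ ⊤ ∧
      ∃ I, I ≠ ⊤ ∧ 1 ≤ flatTransition κ ha I I ∧ 0 < flatTransition κ ha ⊤ I := by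
  have hq : (1 : ℝ) < Nat.card κ := by exact_mod_cast Finite.one_lt_card
  have htop : flatTransition κ ha ⊤ ⊤ = (Nat.card κ : ℝ) ^
      Module.finrank F ((a.rowArrangement F ha).inter Set.univ) := by
    rw [flatTransition_self ha hF hκ, ← zpow_natCast]
    congr 1
    change _ + ((Set.univ : Set (Fin n)).ncard : ℤ) - n = _
    rw [Set.ncard_univ, Nat.card_fin, add_sub_cancel_right]
    rfl
  by_cases hess : (a.rowArrangement F ha).IsEssential
  swap
  · left
    rw [htop]
    refine one_lt_pow₀ hq fun h0 => hess ?_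
    rw [isEssential_iff_inter_univ]
    exact Submodule.finrank_eq_zero.1 h0
  right
  have hbot := (isEssential_iff_inter_univ _).1 hess
  refine ⟨htop ▸ one_le_pow₀ hq.le, ?_⟩
  have hcol : ¬ (a.rowArrangement F ha).IsColoopFree := fun hc => h ⟨hess, hc⟩
  rw [isColoopFree_iff, not_forall] at hcol
  obtain ⟨i, hi⟩ := hcol
  have hflat : (a.rowArrangement F ha).IsFlat {j | j ≠ i} :=
    (isFlat_iff _).2 fun j hj hji => hi (hji ▸ hj)
  have hne : Module.finrank F ((a.rowArrangement F ha).inter {j | j ≠ i}) ≠ 0 := fun h0 => hi (by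
    rw [Submodule.finrank_eq_zero.1 h0]
    exact bot_le)
  refine ⟨⟨{j | j ≠ i}, hflat⟩, fun h => ?_, ?_, ?_⟩
  · have h' : {j | j ≠ i} = (Set.univ : Set (Fin n)) := congrArg Subtype.val h
    exact (h' ▸ Set.mem_univ i : i ∈ {j | j ≠ i}) rfl
  · rw [flatTransition_self ha hF hκ]
    refine one_le_zpow₀ hq.le ?_
    have h1 := Set.ncard_add_ncard_compl {j | j ≠ i}
    have h2 : {j | j ≠ i}ᶜ = {i} := by ext; simp
    rw [h2, Set.ncard_singleton, Nat.card_fin] at h1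
    dsimp only
    omega
  · have h0 : Module.finrank κ (a.rowZeros κ {j | j ≠ i}) ≠ 0 := by
      rwa [finrank_rowZeros_eq_inter ha hF hκ]
    obtain ⟨v, hv, hv0⟩ := Submodule.exists_mem_ne_zero_of_ne_bot
      (fun h => h0 (Submodule.finrank_eq_zero.2 h))
    have huniv : a.rowZeros κ Set.univ = ⊥ := by
      rw [← Submodule.finrank_eq_zero (R := κ), finrank_rowZeros_eq_inter ha hF hκ, hbot,
        finrank_bot]
    -- A nonzero common zero of the rows other than `i` cannot be a zero of row `i` by essentiality,
    -- so it witnesses a positive entry from the top to this flat.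
    have hvi : Set.univ ∩ a.rowZeroSet v = {j | j ≠ i} := by
      ext j
      constructor
      · rintro ⟨-, hj⟩ rfl
        refine hv0 ((Submodule.mem_bot κ).1 (huniv ▸ Matrix.mem_rowZeros.2 fun l _ => ?_))
        by_cases hl : l = j
        · rw [hl]
          exact hj
        · exact Matrix.mem_rowZeros.1 hv l hl
      · exact fun hj => ⟨Set.mem_univ j, Matrix.mem_rowZeros.1 hv j hj⟩
    have : Nonempty {v : Fin m → κ // Set.univ ∩ a.rowZeroSet v = {j | j ≠ i}} := ⟨⟨v, hvi⟩⟩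
    have hpos : 0 < Nat.card {v : Fin m → κ // Set.univ ∩ a.rowZeroSet v = {j | j ≠ i}} :=
      Nat.card_pos
    exact mul_pos (by exact_mod_cast hpos) (zpow_pos (by linarith) _)

end Transition

/-! ### Telescoping, invertibility of the minors, and the limit -/

theorem Fin.prod_div_succ_castSucc {r : ℕ} (f : Fin (r + 1) → ℝ) (hf : ∀ i, f i ≠ 0) :
    ∏ i : Fin r, f i.castSucc / f i.succ = f 0 / f (Fin.last r) := by
  induction r with
  | zero => simp [hf]
  | succ r ih =>
    rw [Fin.prod_univ_castSucc]
    have h := ih (fun i => f i.castSucc) fun i => hf _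
    simp only [Fin.castSucc_zero] at h
    have e : ∀ i : Fin r, f i.castSucc.castSucc / f i.castSucc.succ =
        f i.castSucc.castSucc / f i.succ.castSucc := fun _ => rfl
    rw [Finset.prod_congr rfl fun i _ => e i, h, Fin.succ_last]
    exact div_mul_div_cancel₀ (hf _)

theorem Matrix.UnitMinors.map {R S : Type*} [CommRing R] [CommRing S] (f : R →+* S) {n m : ℕ}
    {a : Matrix (Fin n) (Fin m) ℤ} (h : a.UnitMinors R) : a.UnitMinors S := fun _ r c hd => by
  have := (h r c hd).map f
  rwa [map_intCast] at this

/-- A nonzero integer smaller in absolute value than the residue characteristic is nonzero in the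
residue field, hence a unit. -/
theorem Matrix.unitMinors_of_abs_lt {O : Type*} [CommRing O] [IsLocalRing O] {n m : ℕ}
    {a : Matrix (Fin n) (Fin m) ℤ}
    (hminors : ∀ (l : ℕ) (r : Fin l ↪o Fin n) (c : Fin l ↪o Fin m),
      |(a.submatrix r c).det| < (ringChar (IsLocalRing.ResidueField O) : ℤ)) : a.UnitMinors O := by
  intro l r c hd
  rw [← IsLocalRing.residue_ne_zero_iff_isUnit, map_intCast]
  intro h
  rw [CharP.intCast_eq_zero_iff _ (ringChar (IsLocalRing.ResidueField O))] at h
  exact hd (Int.eq_zero_of_abs_lt_dvd h (a.abs_det_submatrix_lt hminors r c hd))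

open CentralArrangement IsLocalRing in
theorem tendsto_weightSum {F O : Type*} [Field F] [CommRing O] [IsDomain O]
    [IsDiscreteValuationRing O] [Finite (ResidueField O)] [∀ α, Fintype (O ⧸ maximalIdeal O ^ α)]
    {n m : ℕ} {a : Matrix (Fin n) (Fin m) ℤ}
    (ha : ∀ i, ∃ j, (a i j : F) ≠ 0) (hF : a.UnitMinors F) (hO : a.UnitMinors O)
    (q : ℕ) (hq : q = Nat.card (ResidueField O))
    (A : CentralArrangement F (Fin m → F) (Fin n)) (hA : A = a.rowArrangement F ha) :
    (A.IsEssential ∧ A.IsColoopFree → Tendsto (fun α => weightSum O a α Set.univ) atTop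
      (𝓝 (∑ r ∈ Finset.range (n + 1), ∑ c : A.Chain r,
          ((q : ℝ) ^ (A.restriction (c.1 (Fin.last r)).1 (c.1 (Fin.last r)).2).rank)⁻¹ *
            ∏ i : Fin r,
              (((A.subquotient (c.1 i.succ) (c.1 i.castSucc) (c.succ_le i)).charPoly.eval
                  (q : ℤ) : ℤ) : ℝ) /
                ((q : ℝ) ^ (A.delta (c.1 i.succ).1 - m) - 1)))) ∧
    (¬ (A.IsEssential ∧ A.IsColoopFree) →
      Tendsto (fun α => weightSum O a α Set.univ) atTop atTop) := by
  classical
  subst hA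
  set A := a.rowArrangement F ha with hA
  have := Fintype.ofFinite (ResidueField O)
  have hκ : a.UnitMinors (ResidueField O) := hO.map (residue O)
  have hq1 : (1 : ℝ) < Nat.card (ResidueField O) := by exact_mod_cast Finite.one_lt_card
  have hq0 : (Nat.card (ResidueField O) : ℝ) ≠ 0 := by linarith
  have h0 : ∀ I : A.Flat, weightSum O a 0 I.1 = 1 := fun I => weightSum_zero O a I.1
  have hrec : ∀ α (I : A.Flat), weightSum O a (α + 1) I.1 =
      ∑ J, flatTransition (ResidueField O) ha I J * weightSum O a α J.1 := fun α I => by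
    rw [weightSum_succ a hO]
    exact sum_rowZeroSet_eq_sum_flat ha hF hκ I _
  constructor
  · rintro ⟨hess, hcol⟩
    have hbot := (isEssential_iff_inter_univ _).1 hess
    have htop : flatTransition (ResidueField O) ha ⊤ ⊤ = 1 := by
      rw [flatTransition_self ha hF hκ]
      change _ ^ ((Module.finrank F (A.inter Set.univ) : ℤ) +
        (Set.univ : Set (Fin n)).ncard - n) = _
      rw [hbot, finrank_bot, Set.ncard_univ, Nat.card_fin]
      simp
    have hlt : ∀ I : A.Flat, I ≠ ⊤ → flatTransition (ResidueField O) ha I I < 1 := by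
      intro I hI
      rw [flatTransition_self ha hF hκ]
      refine zpow_lt_one_of_neg₀ hq1 ?_
      have h := (a.rowArrangement F ha).finrank_inter_add_ncard_lt hess hcol (I := I.1)
        fun h => hI (Subtype.ext h)
      rw [Nat.card_fin] at h
      omega
    have hempty : IsEmpty (A.Chain (n + 1)) := ⟨fun c => by
      have := c.length_le
      rw [Nat.card_fin] at this
      omega⟩
    let _ : ∀ r, Fintype {c : Fin (r + 1) → A.Flat // c 0 = ⊤ ∧ StrictAnti c} := fun r =>
      (inferInstance : Fintype (A.Chain r))
    have hlim := tendsto_top_of_triangular (f := fun α (I : A.Flat) => weightSum O a α I.1)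
      (flatTransition_nonneg (κ := ResidueField O) ha)
      (flatTransition_of_not_le ha) h0 hrec htop hlt (n + 1) hempty
    refine Eq.subst (motive := fun x => Tendsto _ atTop (𝓝 x)) ?_ hlim
    refine Finset.sum_congr rfl fun r _ => Finset.sum_congr rfl fun c _ => ?_
    have hprod : ∀ i : Fin r, flatTransition (ResidueField O) ha (c.1 i.castSucc) (c.1 i.succ) /
        (1 - flatTransition (ResidueField O) ha (c.1 i.succ) (c.1 i.succ)) = _ := fun i =>
      flatTransition_div ha hF hκ (c.1 i.succ) (c.1 i.castSucc) (Chain.succ_le (A := A) c i)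
    -- The powers of `q` telescope to `q^(dim H_∞) / q^(dim H_{I_r})`. Essentiality gives `dim H_∞ =
    -- 0` and identifies `dim H_{I_r}` with the rank of the restriction.
    rw [Finset.prod_congr rfl fun i _ => hprod i, Finset.prod_mul_distrib,
      Fin.prod_div_succ_castSucc (fun i => (Nat.card (ResidueField O) : ℝ) ^
        Module.finrank F (A.inter (c.1 i).1)) fun i => pow_ne_zero _ hq0, hq]
    have hrank := A.rank_restriction_add (c.1 (Fin.last r)).1 (c.1 (Fin.last r)).2
    rw [hbot, finrank_bot, add_zero] at hrank
    have hc0 : (c.1 0).1 = Set.univ := congrArg Subtype.val c.2.1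
    rw [hrank, hc0, hbot, finrank_bot, pow_zero, one_div]
  · intro h
    exact tendsto_top_atTop_of_triangular (f := fun α (I : A.Flat) => weightSum O a α I.1)
      (flatTransition_nonneg (κ := ResidueField O) ha) h0 hrec (diverging_entries ha hF hκ h)

theorem mainTheorem7 {F : Type*} [Field F] [ValuativeRel F] [TopologicalSpace F]
    [IsNonarchimedeanLocalField F] (n m : ℕ) (a : Matrix (Fin n) (Fin m) ℤ)
    (ha : ∀ i, ∃ j, (a i j : F) ≠ 0)
    (hminors : ∀ (l : ℕ) (r : Fin l ↪o Fin n) (c : Fin l ↪o Fin m),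
      |(a.submatrix r c).det| < (ringChar 𝓀[F] : ℤ))
    (q : ℕ) (hq : q = Nat.card 𝓀[F])
    (A : CentralArrangement F (Fin m → F) (Fin n)) (hA : A = a.rowArrangement F ha) :
    ∃ B : ℝ≥0∞,
      Tendsto (fun α : ℕ => ENNReal.ofReal
          ((momentZeroCount (𝒪[F] ⧸ 𝓂[F] ^ α) a : ℝ) / (q : ℝ) ^ ((α : ℤ) * (2 * n - m))))
        atTop (𝓝 B) ∧
      (B < ∞ ↔ A.IsEssential ∧ A.IsColoopFree) ∧
      (A.IsEssential ∧ A.IsColoopFree →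
        B.toReal = ∑ r ∈ Finset.range (n + 1), ∑ c : A.Chain r,
          ((q : ℝ) ^ (A.restriction (c.1 (Fin.last r)).1 (c.1 (Fin.last r)).2).rank)⁻¹ *
            ∏ i : Fin r,
              (((A.subquotient (c.1 i.succ) (c.1 i.castSucc) (c.succ_le i)).charPoly.eval
                  (q : ℤ) : ℤ) : ℝ) /
                ((q : ℝ) ^ (A.delta (c.1 i.succ).1 - m) - 1)) := by
  classical
  have hfin : ∀ α, Finite (𝒪[F] ⧸ 𝓂[F] ^ α) := fun α => finite_quotient_maximalIdeal_pow α
  let _ : ∀ α, Fintype (𝒪[F] ⧸ 𝓂[F] ^ α) := fun α => Fintype.ofFinite _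
  have hO : a.UnitMinors 𝒪[F] := Matrix.unitMinors_of_abs_lt hminors
  have hF : a.UnitMinors F := hO.map (algebraMap 𝒪[F] F)
  -- At the full index set every row carries its true weight, so the weighted sum is the Fourier
  -- expression of the count.
  have hcount : ∀ α : ℕ, (momentZeroCount (𝒪[F] ⧸ 𝓂[F] ^ α) a : ℝ) /
      (q : ℝ) ^ ((α : ℤ) * (2 * n - m)) = weightSum 𝒪[F] a α Set.univ := by
    intro α
    obtain ⟨ψ, hψ⟩ := exists_isPrimitive_addChar (O := 𝒪[F]) α
    have h := momentZeroCount_div_card_zpow a hψ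
    rw [card_quotient_maximalIdeal_pow, ← hq, Nat.cast_pow, ← zpow_natCast, ← zpow_mul] at h
    rw [h]
    simp [weightSum]
  simp only [hcount]
  obtain ⟨hconv, hdiv⟩ := tendsto_weightSum ha hF hO q hq A hA
  by_cases h : A.IsEssential ∧ A.IsColoopFree
  · have hlim := hconv h
    refine ⟨_, ENNReal.tendsto_ofReal hlim, ⟨fun _ => h, fun _ => ENNReal.ofReal_lt_top⟩,
      fun _ => ENNReal.toReal_ofReal (ge_of_tendsto' hlim fun α => ?_)⟩
    rw [weightSum]
    exact Finset.sum_nonneg fun ξ _ => Finset.prod_nonneg fun i _ =>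
      div_nonneg (Nat.cast_nonneg _) (Nat.cast_nonneg _)
  · exact ⟨∞, ENNReal.tendsto_ofReal_atTop.comp (hdiv h),
      ⟨fun h' => absurd h' (lt_irrefl _), fun h' => absurd h' h⟩, fun h' => absurd h' h⟩
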